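/- **Setting.** Let $U\subset\mathbb R^3$ be a bounded open set, $T>0$, $I_T=[0,T)$, and $e(\boldsymbol u)=\frac12(\nabla \boldsymbol u+\nabla \boldsymbol u^{\mathsf T})$. Let $\mu_1,\mu_2,\nu_1,\nu_2>0$. For each $\varepsilon$ in a sequence $\{\varepsilon_k\}_{k\ge 1}$ let $\theta^\varepsilon$ be the characteristic function of a measurable set (the region occupied by phase one; no other assumption on the geometry is made), and let $\boldsymbol A^\varepsilon,\boldsymbol B^\varepsilon$ act on $3\times3$ matrices by $$\boldsymbol A^\varepsilon\boldsymbol\xi=(\mu_1\theta^\varepsilon+\mu_2(1-\theta^\varepsilon))\boldsymbol\xi,\qquad \boldsymbol B^\varepsilon\boldsymbol\xi=(\nu_1\theta^\varepsilon+\nu_2(1-\theta^\varepsilon))\boldsymbol\xi .$$ Let $V=\{\boldsymbol v\in H_0^1(U;\mathbb R^3):\operatorname{div}\boldsymbol v=0\}$, $\mathcal V=L^2(I_T,V)$, $\mathcal W=\{\boldsymbol v\in\mathcal V:\boldsymbol v_t\in\mathcal V\}$ with the norm $(\|\boldsymbol v\|_{\mathcal V}^2+\|\boldsymbol v_t\|_{\mathcal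 V}^2)^{1/2}$, and $\mathcal W_T=\{\boldsymbol v\in\mathcal W:\boldsymbol v(T)=0\}$, a closed subspace of $\mathcal W$ with the same norm. Given $\boldsymbol f\in\mathcal V^\star$ and $\boldsymbol m_T^\varepsilon\in V$, the solution $\boldsymbol m^\varepsilon\in\mathcal W$ of the auxiliary problem $$-\operatorname{div}\left(\boldsymbol A^\varepsilon e(\boldsymbol m^\varepsilon)-\boldsymbol B^\varepsilon e(\boldsymbol m^\varepsilon_t)\right)-\nabla P^\varepsilon=\boldsymbol f,\qquad \operatorname{div}\boldsymbol m^\varepsilon=0,\qquad \boldsymbol m^\varepsilon(T)=\boldsymbol m^\varepsilon_T \tag{1}$$ is understood weakly: $\boldsymbol m^\varepsilon(T)=\boldsymbol m^\varepsilon_T$ and $\int_0^T\int_U(\boldsymbol A^\varepsilon e(\boldsymbol m^\varepsilon)-\boldsymbol B^\varepsilon e(\boldsymbol m^\varepsilon_t))\cdot e(\boldsymbol\phi)\,d\boldsymbol x\,dt=\langle \boldsymbol f,\boldsymbol\phi\rangle$ for all $\boldsymbol\phi\in\mathcal V$. For fixed $p,q\in\{1,2,3\}$ put $\boldsymbol I^{pq}=\frac12(\mathbf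 e_p\otimes\mathbf e_q+\mathbf e_q\otimes\mathbf e_p)$. Given $\boldsymbol f_1,\boldsymbol f_2\in V^\star$, let $\boldsymbol n^\varepsilon,\boldsymbol m_T^\varepsilon\in V$ be the solutions of $$\int_U\boldsymbol A^\varepsilon(\boldsymbol I^{pq}+e(\boldsymbol n^\varepsilon))\cdot e(\boldsymbol w)\,d\boldsymbol x=\langle \boldsymbol f_1,\boldsymbol w\rangle,\qquad \int_U\boldsymbol B^\varepsilon(\boldsymbol I^{pq}+e(\boldsymbol n^\varepsilon)-e(\boldsymbol m_T^\varepsilon))\cdot e(\boldsymbol w)\,d\boldsymbol x=\langle \boldsymbol f_2,\boldsymbol w\rangle\qquad\text{for all }\boldsymbol w\in V. \tag{2}$$ **Proposition.** (a) For all $p,q$ there exist $\boldsymbol f_1,\boldsymbol f_2\in V^\star$ such that the problems (2) have unique solutions $\boldsymbol n^\varepsilon,\boldsymbol m^\varepsilon_T\in V$ for every $\varepsilon$, and, along a subsequence, $\boldsymbol n^\varepsilon\to0$ and $\boldsymbol m_T^\varepsilon\to0$ weakly in $V$. (b) Let $\boldsymbol m_T^\varepsilon\in V$ be these final data or, more generally,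 any final data with $\boldsymbol m_T^\varepsilon\to0$ weakly in $V$ along a subsequence. Then there exists $\boldsymbol f\in\mathcal V^\star$ such that (1) with this right-hand side has a unique solution $\boldsymbol m^\varepsilon\in\mathcal W$ for every $\varepsilon$, and, along a further subsequence, (i) $\boldsymbol m^\varepsilon\to0$ weakly, in the norm topology of $\mathcal W_T$ (that is, weakly in $\mathcal W$, where the $\boldsymbol m^\varepsilon$ lie); (ii) $\boldsymbol m^\varepsilon\to0$ strongly in $L^2(I_T,L^2(U))$. -/

import Mathlib

open MeasureTheory Filter Topology Set
open scoped ContDiff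

set_option maxSynthPendingDepth 3

namespace Viscoelastic

noncomputable section

/-! ### Function spaces on `U ⊆ ℝ³` -/

/-- Points and vectors of `ℝ³`, with the Euclidean norm. -/
abbrev E3 : Type := EuclideanSpace ℝ (Fin 3)

/-- Real `3 × 3` matrices; the inner product is `ξ · η = ∑ i j, ξ i j * η i j`. -/
abbrev M3 : Type := EuclideanSpace ℝ (Fin 3 × Fin 3)

/-- The (full) gradient `(∂ⱼ wᵢ)ᵢⱼ` of a vector field `w`. -/
def gradMat (w : E3 → E3) (x : E3) : M3 :=
  WithLp.toLp 2 fun ij => (fderiv ℝ w x (EuclideanSpace.single ij.2 1)) ij.1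

/-- `ξ ↦ (ξ + ξᵀ) / 2`; the strain is `e(u) = symPart (∇u)`. -/
def symPart (ξ : M3) : M3 :=
  WithLp.toLp 2 fun ij => (ξ (ij.1, ij.2) + ξ (ij.2, ij.1)) / 2

/-- `I^{pq} = (e_p ⊗ e_q + e_q ⊗ e_p) / 2`. -/
def unitStrain (p q : Fin 3) : M3 := symPart (EuclideanSpace.single (p, q) 1)

/-- The trace of a matrix; `div u = traceM (∇u)`. -/
def traceM : M3 →L[ℝ] ℝ := ∑ i : Fin 3, EuclideanSpace.proj (i, i)

/-- Lebesgue measure on `U`. -/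
abbrev volU (U : Set E3) : Measure E3 := volume.restrict U

/-- `L²(U; ℝ³)`. -/
abbrev L2vec (U : Set E3) : Type := Lp E3 2 (volU U)

/-- `L²(U; ℝ³ˣ³)`. -/
abbrev L2mat (U : Set E3) : Type := Lp M3 2 (volU U)

/-- Pairs `(u, g)`, with the norm `(‖u‖² + ‖g‖²)^{1/2}`. An `H¹` function `u` is represented in
this space by the pair `(u, ∇u)`, and the norm of that pair is the `H¹` norm of `u`. -/
abbrev PairSpace (U : Set E3) : Type := WithLp 2 (L2vec U × L2mat U)

/-- The pairs `(w, ∇w)` for `w ∈ C_c^∞(U; ℝ³)`. -/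
def testPairs (U : Set E3) : Set (PairSpace U) :=
  {z | ∃ w : E3 → E3, ContDiff ℝ ∞ w ∧ HasCompactSupport w ∧ tsupport w ⊆ U ∧
    z.fst =ᵐ[volU U] w ∧ z.snd =ᵐ[volU U] gradMat w}

/-- `H₀¹(U; ℝ³)`: the closure of `C_c^∞(U; ℝ³)` in the `H¹` norm. -/
def H10 (U : Set E3) : Submodule ℝ (PairSpace U) :=
  (Submodule.span ℝ (testPairs U)).topologicalClosure

/-- `u ↦ div u`, as the trace of the gradient component. -/
def divL (U : Set E3) : PairSpace U →L[ℝ] Lp ℝ 2 (volU U) :=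
  (traceM.compLpL 2 (volU U)).comp (WithLp.sndL 2 ℝ (L2vec U) (L2mat U))

/-- `V = {v ∈ H₀¹(U; ℝ³) : div v = 0}`, with the `H¹` norm (which on `H₀¹` is equivalent to
`(∫_U e(v) · e(v))^{1/2}` by Korn's inequality: the dual and the weak topology are the same). -/
def V (U : Set E3) : Submodule ℝ (PairSpace U) := H10 U ⊓ (divL U).toLinearMap.ker

/-- The gradient of an element of `V`. -/
def grad {U : Set E3} (v : V U) : L2mat U := (v : PairSpace U).snd

/-- The strain `e(v)` of an element of `V`. -/
def strain {U : Set E3} (v : V U) (x : E3) : M3 := symPart (grad v x)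

/-- The inclusion `V → L²(U; ℝ³)`. -/
def toL2 (U : Set E3) : V U →L[ℝ] L2vec U :=
  (WithLp.fstL 2 ℝ (L2vec U) (L2mat U)).comp (V U).subtypeL

/-! ### Function spaces on `I_T × U` -/

/-- Lebesgue measure on the time interval. -/
abbrev volT (T : ℝ) : Measure ℝ := volume.restrict (Ioo 0 T)

/-- `𝒱 = {v ∈ L²(I_T, H₀¹(U)) : div v = 0} = L²(I_T, V)`. -/
abbrev VT (U : Set E3) (T : ℝ) : Type := Lp (V U) 2 (volT T)

/-- `w` is the weak time derivative of `u` on `(0, T)`. -/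
def IsTimeDeriv {U : Set E3} {T : ℝ} (u w : VT U T) : Prop :=
  ∀ (η : ℝ → ℝ), ContDiff ℝ ∞ η → HasCompactSupport η → tsupport η ⊆ Ioo 0 T →
    ∀ l : StrongDual ℝ (V U),
      ∫ t in Ioo 0 T, deriv η t * l (u t) = -∫ t in Ioo 0 T, η t * l (w t)

theorem integrable_test {U : Set E3} {T : ℝ} (u : VT U T) (l : StrongDual ℝ (V U))
    {g : ℝ → ℝ} (hg : Continuous g) (hc : HasCompactSupport g) :
    Integrable (fun t => g t * l (u t)) (volT T) := by
  have h1 : MemLp (fun t => l (u t)) 2 (volT T) := l.comp_memLp u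
  have h2 : Integrable (fun t => l (u t)) (volT T) := h1.integrable (by norm_num)
  obtain ⟨C, hC⟩ := hc.exists_bound_of_continuous hg
  exact h2.bdd_mul hg.aestronglyMeasurable (Eventually.of_forall hC)

/-- `𝒲 = {v ∈ 𝒱 : v_t ∈ 𝒱}`, as the space of the pairs `(v, v_t)`, with the norm
`(‖v‖² + ‖v_t‖²)^{1/2}`. -/
def W (U : Set E3) (T : ℝ) : Submodule ℝ (WithLp 2 (VT U T × VT U T)) where
  carrier := {z | IsTimeDeriv z.fst z.snd}
  zero_mem' := by
    intro η _ _ _ l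
    have h0 : ∀ᵐ t ∂(volT T), (0 : VT U T) t = 0 := Lp.coeFn_zero _ _ _
    have h1 : ∫ t in Ioo 0 T, deriv η t * l ((0 : VT U T) t) = 0 := by
      refine integral_eq_zero_of_ae ?_
      filter_upwards [h0] with t ht
      rw [ht, map_zero, mul_zero, Pi.zero_apply]
    have h2 : ∫ t in Ioo 0 T, η t * l ((0 : VT U T) t) = 0 := by
      refine integral_eq_zero_of_ae ?_
      filter_upwards [h0] with t ht
      rw [ht, map_zero, mul_zero, Pi.zero_apply]
    simp only [WithLp.zero_fst, WithLp.zero_snd]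
    rw [h1, h2, neg_zero]
  add_mem' := by
    intro a b ha hb η h1 h2 h3 l
    have key : ∀ (g : ℝ → ℝ), Continuous g → HasCompactSupport g → ∀ u v : VT U T,
        ∫ t in Ioo 0 T, g t * l ((u + v : VT U T) t) =
          (∫ t in Ioo 0 T, g t * l (u t)) + ∫ t in Ioo 0 T, g t * l (v t) := by
      intro g hg hc u v
      rw [← integral_add (integrable_test u l hg hc) (integrable_test v l hg hc)]
      refine integral_congr_ae ?_
      filter_upwards [Lp.coeFn_add u v] with t ht
      rw [ht, Pi.add_apply, map_add, mul_add]
    simp only [WithLp.add_fst, WithLp.add_snd]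
    rw [key _ (h1.continuous_deriv (by simp)) h2.deriv, key _ h1.continuous h2,
      ha η h1 h2 h3 l, hb η h1 h2 h3 l, neg_add]
  smul_mem' := by
    intro c a ha η h1 h2 h3 l
    have key : ∀ (g : ℝ → ℝ) (u : VT U T),
        ∫ t in Ioo 0 T, g t * l ((c • u : VT U T) t) = c * ∫ t in Ioo 0 T, g t * l (u t) := by
      intro g u
      rw [← integral_const_mul]
      refine integral_congr_ae ?_
      filter_upwards [Lp.coeFn_smul c u] with t ht
      rw [ht, Pi.smul_apply, map_smul, smul_eq_mul]
      ring
    simp only [WithLp.smul_fst, WithLp.smul_snd]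
    rw [key, key, ha η h1 h2 h3 l, mul_neg]

/-- The underlying element `m` of `𝒱`, for `m ∈ 𝒲`. -/
def val {U : Set E3} {T : ℝ} (m : W U T) : VT U T := (m : WithLp 2 (VT U T × VT U T)).fst

/-- The time derivative `m_t ∈ 𝒱`, for `m ∈ 𝒲`. -/
def dt {U : Set E3} {T : ℝ} (m : W U T) : VT U T := (m : WithLp 2 (VT U T × VT U T)).snd

/-- `m(T) = a`, for the continuous representative of `m` on `[0, T]`. -/
def HasFinalValue {U : Set E3} {T : ℝ} (m : W U T) (a : V U) : Prop :=
  ∃ r : ℝ → V U, ContinuousOn r (Icc 0 T) ∧ val m =ᵐ[volT T] r ∧ r T = a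

/-- `m` as an element of `L²(I_T, L²(U))`. -/
def toL2L2 {U : Set E3} {T : ℝ} (m : W U T) : Lp (L2vec U) 2 (volT T) :=
  (toL2 U).compLp (val m)

/-- Weak convergence to zero of a sequence in a normed space. -/
def WeaklyNull {X : Type*} [NormedAddCommGroup X] [NormedSpace ℝ X] (u : ℕ → X) : Prop :=
  Tendsto (fun k => toWeakSpace ℝ X (u k)) atTop (𝓝 0)

/-! ### The two-phase material and the auxiliary problems -/

/-- The modulus at the point `x` of the two-phase isotropic tensor that is `c₁ δ_ik δ_jl` in the
phase `S` and `c₂ δ_ik δ_jl` in the other one. -/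
def modulus (S : Set E3) (c₁ c₂ : ℝ) (x : E3) : ℝ :=
  open Classical in if x ∈ S then c₁ else c₂

/-- The action of the two-phase isotropic tensor on a matrix: `c δ_ik δ_jl ξ_kl = c ξ_ij`. -/
def tensor (S : Set E3) (c₁ c₂ : ℝ) (x : E3) (ξ : M3) : M3 := modulus S c₁ c₂ x • ξ

/-- `n ∈ V` is a weak solution of
`-div (A (I^{pq} + e(n))) - ∇P₁ = f₁`, `div n = 0`. -/
def IsSolN {U : Set E3} (S : Set E3) (μ₁ μ₂ : ℝ) (p q : Fin 3) (f₁ : StrongDual ℝ (V U))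
    (n : V U) : Prop :=
  ∀ w : V U,
    ∫ x in U, inner ℝ (tensor S μ₁ μ₂ x (unitStrain p q + strain n x)) (strain w x) = f₁ w

/-- `a ∈ V` is a weak solution of
`-div (B (I^{pq} + e(n) - e(a))) - ∇P₂ = f₂`, `div a = 0`. -/
def IsSolMT {U : Set E3} (S : Set E3) (ν₁ ν₂ : ℝ) (p q : Fin 3) (f₂ : StrongDual ℝ (V U))
    (n a : V U) : Prop :=
  ∀ w : V U,
    ∫ x in U, inner ℝ (tensor S ν₁ ν₂ x (unitStrain p q + strain n x - strain a x))
      (strain w x) = f₂ w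

/-- `m ∈ 𝒲` is a weak solution of
`-div (A e(m) - B e(m_t)) - ∇P₃ = f`, `div m = 0`, `m(T) = a`. -/
def IsSolM {U : Set E3} {T : ℝ} (S : Set E3) (μ₁ μ₂ ν₁ ν₂ : ℝ) (f : StrongDual ℝ (VT U T))
    (a : V U) (m : W U T) : Prop :=
  HasFinalValue m a ∧
  ∀ φ : VT U T,
    ∫ t in Ioo 0 T, ∫ x in U,
      inner ℝ (tensor S μ₁ μ₂ x (strain (val m t) x) - tensor S ν₁ ν₂ x (strain (dt m t) x))
        (strain (φ t) x) = f φ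

end

end Viscoelastic

/-!
Each of the three problems is an equation `L k x = f - b k` in a separable Hilbert space (`V` for
the two stationary ones, the second being an equation for `n - m_T`, and `𝒱 = L²(0, T; V)` for
the evolution) with operators `L k` that are
bounded and coercive uniformly in `k`. For such operators (`exists_rhs_weaklyNull`) the inverses
converge, along a subsequence, in the weak operator topology; the limit `R₀` is again coercive,
hence onto. If the bounded sequence `(L k)⁻¹ (b k)` converges weakly to `z₀`, then a right-hand
side `f` with `R₀ f = z₀` makes the solutions `(L k)⁻¹ f - (L k)⁻¹ (b k)` weakly null. No
information on the geometry of the phases is needed.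

Coercivity on `V` is the inequality `c ‖v‖² ≤ ‖e(v)‖²` (`exists_coercive_strainL`): integrating by
parts twice gives `∫ ∂ⱼvᵢ ∂ᵢvⱼ = ∫ (div v)² = 0`, so `‖e(v)‖² = ½ ‖∇v‖²`, and Poincaré's
inequality controls `v`. For the evolution problem `𝒜 m - ℬ m_t = f`, `m(T) = a`, the unknown is
the rate `g = -m_t`. By the du Bois-Reymond lemma an element of `𝒲` with final value `a` is `m = a
+ J g` with `(J g)(t) = ∫ₜᵀ g`, so the problem becomes `𝒜 (J g) + ℬ g = f - 𝒜 a`. This operator is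
coercive because `ℬ` is and `∫₀ᵀ ⟨𝒜 (J g), g⟩ = ½ ⟨𝒜 (J g)(0), (J g)(0)⟩ ≥ 0`
(`inner_compLpL_primitiveL_nonneg`). Since `(a, g) ↦ a + J g` is bounded from `V × 𝒱` to `𝒲`, weak
convergence of the final data and of the rates gives weak convergence in `𝒲`.

Strong convergence in `L²(0, T; L²(U))` follows because evaluation at a time `t` is bounded on
such `m`, so that `m(t)` is weakly null in `V` for every `t`; Rellich's theorem
(`WeaklyNull.tendsto_toL2`) and dominated convergence conclude. Rellich's theorem is proved with
the Fourier transform: low frequencies converge pointwise and boundedly, high frequencies are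
controlled by the gradient.
-/

namespace Viscoelastic

noncomputable section

/-! ### Weakly null sequences -/

section WeaklyNull

variable {X Y : Type*} [NormedAddCommGroup X] [NormedSpace ℝ X]
  [NormedAddCommGroup Y] [NormedSpace ℝ Y]

theorem weaklyNull_iff {u : ℕ → X} :
    WeaklyNull u ↔ ∀ l : StrongDual ℝ X, Tendsto (fun k => l (u k)) atTop (𝓝 0) := by
  unfold WeaklyNull
  have hinj : Function.Injective (topDualPairing ℝ X).flip := fun x y h =>
    (SeparatingDual.eq_iff_forall_dual_eq (R := ℝ)).2 fun l => by
      simpa using congrArg (fun F => F l) h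
  rw [← map_zero (toWeakSpace ℝ X)]
  refine (WeakBilin.tendsto_iff_forall_eval_tendsto _ hinj).trans (forall_congr' fun l => ?_)
  rw [← map_zero l]
  rfl

theorem WeaklyNull.map {u : ℕ → X} (hu : WeaklyNull u) (L : X →L[ℝ] Y) :
    WeaklyNull fun k => L (u k) :=
  weaklyNull_iff.2 fun l => weaklyNull_iff.1 hu (l.comp L)

theorem WeaklyNull.add {u v : ℕ → X} (hu : WeaklyNull u) (hv : WeaklyNull v) :
    WeaklyNull fun k => u k + v k := by
  refine weaklyNull_iff.2 fun l => ?_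
  simpa using (weaklyNull_iff.1 hu l).add (weaklyNull_iff.1 hv l)

theorem WeaklyNull.sub {u v : ℕ → X} (hu : WeaklyNull u) (hv : WeaklyNull v) :
    WeaklyNull fun k => u k - v k := by
  refine weaklyNull_iff.2 fun l => ?_
  simpa using (weaklyNull_iff.1 hu l).sub (weaklyNull_iff.1 hv l)

theorem WeaklyNull.subseq {u : ℕ → X} (hu : WeaklyNull u) {τ : ℕ → ℕ} (hτ : StrictMono τ) :
    WeaklyNull (u ∘ τ) :=
  Tendsto.comp (g := fun k => toWeakSpace ℝ X (u k)) hu hτ.tendsto_atTop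

end WeaklyNull

theorem norm_symm_apply_le {H : Type*} [NormedAddCommGroup H]
    [InnerProductSpace ℝ H] {e : H ≃L[ℝ] H} {c : ℝ} (hc : 0 < c)
    (he : ∀ u, c * ‖u‖ ^ 2 ≤ inner ℝ (e u) u) (f : H) : ‖e.symm f‖ ≤ c⁻¹ * ‖f‖ := by
  have h := (he (e.symm f)).trans (real_inner_le_norm _ _)
  rw [e.apply_symm_apply] at h
  rw [inv_mul_eq_div, le_div_iff₀ hc]
  rcases (norm_nonneg (e.symm f)).eq_or_lt with h0 | h0
  · rw [← h0]; simp
  · nlinarith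

theorem equiv_apply_eq_sub_iff {H : Type*} [NormedAddCommGroup H] [InnerProductSpace ℝ H]
    (e : H ≃L[ℝ] H) (f g v : H) : e v = f - g ↔ v = e.symm f - e.symm g := by
  rw [← map_sub, ContinuousLinearEquiv.eq_symm_apply]

section Hilbert

variable {H : Type*} [NormedAddCommGroup H] [InnerProductSpace ℝ H] [CompleteSpace H]

theorem weaklyNull_iff_inner {u : ℕ → H} :
    WeaklyNull u ↔ ∀ g : H, Tendsto (fun k => inner ℝ (u k) g) atTop (𝓝 0) := by
  rw [weaklyNull_iff]
  constructor
  · intro h g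
    simpa [real_inner_comm] using h (innerSL ℝ g)
  · intro h l
    have := h ((InnerProductSpace.toDual ℝ H).symm l)
    refine this.congr fun k => ?_
    rw [real_inner_comm, InnerProductSpace.toDual_symm_apply]

theorem WeaklyNull.exists_norm_le {u : ℕ → H} (hu : WeaklyNull u) : ∃ C, ∀ k, ‖u k‖ ≤ C := by
  have h := banach_steinhaus (g := fun k => innerSL ℝ (u k)) (fun g => by
    obtain ⟨C, hC⟩ := (weaklyNull_iff_inner.1 hu g).norm.bddAbove_range
    exact ⟨C, fun k => hC ⟨k, rfl⟩⟩)
  simpa using h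

theorem exists_subseq_tendsto_real {ι : Type*} [Countable ι] (b : ℕ → ι → ℝ) (C : ι → ℝ)
    (hb : ∀ k i, |b k i| ≤ C i) :
    ∃ τ : ℕ → ℕ, StrictMono τ ∧ ∀ i, ∃ l, Tendsto (fun k => b (τ k) i) atTop (𝓝 l) := by
  have hK : IsCompact (Set.pi univ fun i => Icc (-C i) (C i)) :=
    isCompact_univ_pi fun i => isCompact_Icc
  obtain ⟨l, -, τ, hτ, hl⟩ := hK.tendsto_subseq (x := b) fun k i _ => abs_le.1 (hb k i)
  exact ⟨τ, hτ, fun i => ⟨l i, (tendsto_pi_nhds.1 hl) i⟩⟩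

/-- A bounded sequence whose inner products with a dense family converge is weakly convergent. -/
theorem exists_tendsto_inner_of_dense {ι : Type*} {d : ι → H} (hd : DenseRange d) {x : ℕ → H}
    {C : ℝ} (hx : ∀ k, ‖x k‖ ≤ C)
    (h : ∀ i, ∃ l, Tendsto (fun k => (inner ℝ (x k) (d i) : ℝ)) atTop (𝓝 l)) :
    ∃ y : H, ∀ g, Tendsto (fun k => (inner ℝ (x k) g : ℝ)) atTop (𝓝 (inner ℝ y g)) := by
  have hC : 0 ≤ C := (norm_nonneg _).trans (hx 0)
  have hcau : ∀ g, ∃ l, Tendsto (fun k => (inner ℝ (x k) g : ℝ)) atTop (𝓝 l) := by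
    intro g
    refine cauchySeq_tendsto_of_complete (Metric.cauchySeq_iff'.2 fun ε hε => ?_)
    obtain ⟨i, hi⟩ := hd.exists_dist_lt g (ε := ε / (4 * (C + 1))) (by positivity)
    obtain ⟨l, hl⟩ := h i
    obtain ⟨N, hN⟩ := Metric.cauchySeq_iff'.1 hl.cauchySeq (ε / 2) (by positivity)
    refine ⟨N, fun n hn => ?_⟩
    have h1 : ∀ k, |(inner ℝ (x k) g : ℝ) - inner ℝ (x k) (d i)| ≤ ε / 4 := by
      intro k
      rw [← inner_sub_right]
      refine (abs_real_inner_le_norm _ _).trans ?_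
      rw [dist_eq_norm] at hi
      calc ‖x k‖ * ‖g - d i‖ ≤ (C + 1) * (ε / (4 * (C + 1))) := by
            gcongr
            linarith [hx k]
        _ = ε / 4 := by field_simp
    have h2 := hN n hn
    rw [Real.dist_eq] at h2 ⊢
    have h3 := h1 n
    have h4 := h1 N
    rw [abs_le] at h3 h4
    rw [abs_lt] at h2 ⊢
    constructor <;> linarith [h2.1, h2.2, h3.1, h3.2, h4.1, h4.2]
  choose L hL using hcau
  have hLt : Tendsto (fun k g => innerSL ℝ (x k) g) atTop (𝓝 L) :=
    tendsto_pi_nhds.2 fun g => by simpa using hL g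
  let F : H →ₗ[ℝ] ℝ := linearMapOfTendsto L (fun k => (innerSL ℝ (x k) : H →ₗ[ℝ] ℝ)) hLt
  have hF : ∀ g, ‖F g‖ ≤ C * ‖g‖ := fun g => by
    refine le_of_tendsto (hL g).norm (Eventually.of_forall fun k => ?_)
    refine (norm_inner_le_norm _ _).trans ?_
    gcongr
    exact hx k
  refine ⟨(InnerProductSpace.toDual ℝ H).symm (F.mkContinuous C hF), fun g => ?_⟩
  rw [InnerProductSpace.toDual_symm_apply]
  exact hL g

/-! ### Compactness of coercive operators in the weak operator topology -/

/-- The Lax--Milgram theorem for an operator. -/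
theorem exists_equiv_of_coercive (L : H →L[ℝ] H) {c : ℝ} (hc : 0 < c)
    (hL : ∀ u, c * ‖u‖ ^ 2 ≤ inner ℝ (L u) u) :
    ∃ e : H ≃L[ℝ] H, ∀ u, e u = L u := by
  have hB : IsCoercive ((innerSL ℝ).comp L) := ⟨c, hc, fun u => by
    simpa [pow_two, mul_assoc] using hL u⟩
  refine ⟨hB.continuousLinearEquivOfBilin, fun u => ext_inner_right ℝ fun w => ?_⟩
  simp

/-- Bounded sequences of operators and of vectors have a subsequence that converges in the weak
operator topology and weakly, respectively. -/
theorem exists_subseq_weak_operator_limit [TopologicalSpace.SeparableSpace H]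
    (R : ℕ → H →L[ℝ] H) (z : ℕ → H) {C D : ℝ} (hR : ∀ k f, ‖R k f‖ ≤ C * ‖f‖)
    (hz : ∀ k, ‖z k‖ ≤ D) :
    ∃ τ : ℕ → ℕ, StrictMono τ ∧ ∃ (R₀ : H →L[ℝ] H) (z₀ : H),
      (∀ f g, Tendsto (fun k => (inner ℝ (R (τ k) f) g : ℝ)) atTop (𝓝 (inner ℝ (R₀ f) g))) ∧
      ∀ g, Tendsto (fun k => (inner ℝ (z (τ k)) g : ℝ)) atTop (𝓝 (inner ℝ z₀ g)) := by
  let d := TopologicalSpace.denseSeq H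
  have hd : DenseRange d := TopologicalSpace.denseRange_denseSeq H
  obtain ⟨τ, hτ, hlim⟩ := exists_subseq_tendsto_real (ι := (ℕ × ℕ) ⊕ ℕ)
    (fun k => Sum.elim (fun ij => inner ℝ (R k (d ij.1)) (d ij.2)) fun i => inner ℝ (z k) (d i))
    (Sum.elim (fun ij => C * ‖d ij.1‖ * ‖d ij.2‖) fun i => D * ‖d i‖) (by
      rintro k (ij | i)
      · refine (abs_real_inner_le_norm _ _).trans ?_
        simp only [Sum.elim_inl]
        gcongr
        exact hR _ _
      · refine (abs_real_inner_le_norm _ _).trans ?_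
        simp only [Sum.elim_inr]
        gcongr
        exact hz _)
  obtain ⟨z₀, hz₀⟩ := exists_tendsto_inner_of_dense hd (fun k => hz (τ k))
    fun i => hlim (Sum.inr i)
  -- convergence for `f` in the dense sequence, then, through the adjoints, for all `f`
  have h1 : ∀ i g, ∃ l, Tendsto (fun k => (inner ℝ (R (τ k) (d i)) g : ℝ)) atTop (𝓝 l) := by
    intro i g
    obtain ⟨y, hy⟩ := exists_tendsto_inner_of_dense hd (fun k => hR (τ k) (d i))
      fun j => hlim (Sum.inl (i, j))
    exact ⟨_, hy g⟩
  have hadj : ∀ k g, ‖(R k).adjoint g‖ ≤ |C| * ‖g‖ := by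
    intro k g
    refine ((R k).adjoint.le_opNorm g).trans ?_
    gcongr
    rw [LinearIsometryEquiv.norm_map]
    refine ContinuousLinearMap.opNorm_le_bound _ (abs_nonneg _) fun f => (hR k f).trans ?_
    gcongr
    exact le_abs_self C
  have h2 : ∀ f j, ∃ l, Tendsto (fun k => (inner ℝ (R (τ k) f) (d j) : ℝ)) atTop (𝓝 l) := by
    intro f j
    obtain ⟨y, hy⟩ := exists_tendsto_inner_of_dense hd
      (x := fun k => (R (τ k)).adjoint (d j)) (fun k => hadj (τ k) (d j)) fun i => by
        obtain ⟨l, hl⟩ := h1 i (d j)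
        refine ⟨l, ?_⟩
        simpa [ContinuousLinearMap.adjoint_inner_left, real_inner_comm] using hl
    refine ⟨_, (hy f).congr fun k => ?_⟩
    rw [ContinuousLinearMap.adjoint_inner_left, real_inner_comm]
  have h3 : ∀ f, ∃ y : H, ∀ g,
      Tendsto (fun k => (inner ℝ (R (τ k) f) g : ℝ)) atTop (𝓝 (inner ℝ y g)) := fun f =>
    exists_tendsto_inner_of_dense hd (fun k => hR (τ k) f) (h2 f)
  choose R₀ hR₀ using h3
  refine ⟨τ, hτ, LinearMap.mkContinuous
    { toFun := R₀
      map_add' := fun f f' => ext_inner_right ℝ fun g => ?_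
      map_smul' := fun a f => ext_inner_right ℝ fun g => ?_ } |C| fun f => ?_, z₀, hR₀, hz₀⟩
  · refine tendsto_nhds_unique (hR₀ (f + f') g) ?_
    simpa [inner_add_left] using (hR₀ f g).add (hR₀ f' g)
  · refine tendsto_nhds_unique (hR₀ (a • f) g) ?_
    simpa [inner_smul_left] using (hR₀ f g).const_mul a
  · have h4 : ∀ g, (inner ℝ (R₀ f) g : ℝ) ≤ |C| * ‖f‖ * ‖g‖ := fun g => by
      refine le_of_tendsto (hR₀ f g) (Eventually.of_forall fun k => ?_)
      refine (real_inner_le_norm _ _).trans ?_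
      gcongr
      exact (hR _ _).trans (by gcongr; exact le_abs_self C)
    have h5 := h4 (R₀ f)
    rw [real_inner_self_eq_norm_sq] at h5
    rcases (norm_nonneg (R₀ f)).eq_or_lt with h0 | h0
    · simp only [LinearMap.coe_mk, AddHom.coe_mk]
      rw [← h0]; positivity
    · simp only [LinearMap.coe_mk, AddHom.coe_mk]
      nlinarith

/-- Given uniformly bounded, uniformly coercive operators `L k` and a bounded sequence `z k`, there
is a single right-hand side `f` for which the differences `(L k)⁻¹ f - z k` are weakly null along a
subsequence. The inverses have a weak operator limit `R₀`, which inherits a coercivity bound from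
`⟨L⁻¹ f, f⟩ ≥ c ‖L⁻¹ f‖² ≥ c M⁻² ‖f‖²` and is therefore onto. -/
theorem exists_rhs_weaklyNull [TopologicalSpace.SeparableSpace H] (L : ℕ → H ≃L[ℝ] H)
    (z : ℕ → H) {c M D : ℝ} (hc : 0 < c) (hM : 0 < M)
    (hL : ∀ k u, c * ‖u‖ ^ 2 ≤ inner ℝ (L k u) u) (hLM : ∀ k u, ‖L k u‖ ≤ M * ‖u‖)
    (hz : ∀ k, ‖z k‖ ≤ D) :
    ∃ (f : H) (τ : ℕ → ℕ), StrictMono τ ∧ WeaklyNull fun k => (L (τ k)).symm f - z (τ k) := by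
  obtain ⟨τ, hτ, R₀, z₀, hR₀, hz₀⟩ := exists_subseq_weak_operator_limit
    (fun k => ((L k).symm : H →L[ℝ] H)) z (C := c⁻¹)
    (fun k f => norm_symm_apply_le hc (hL k) f) hz
  have hcoer : ∀ f, c / M ^ 2 * ‖f‖ ^ 2 ≤ inner ℝ (R₀ f) f := by
    intro f
    refine ge_of_tendsto (hR₀ f f) (Eventually.of_forall fun k => ?_)
    have h1 := hL (τ k) ((L (τ k)).symm f)
    have h2 := hLM (τ k) ((L (τ k)).symm f)
    rw [ContinuousLinearEquiv.apply_symm_apply] at h1 h2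
    have h3 : ‖f‖ ^ 2 ≤ M ^ 2 * ‖(L (τ k)).symm f‖ ^ 2 := by
      rw [← mul_pow]; gcongr
    rw [real_inner_comm] at h1
    refine le_trans ?_ h1
    rw [div_mul_eq_mul_div, div_le_iff₀ (by positivity)]
    nlinarith
  obtain ⟨e, he⟩ := exists_equiv_of_coercive R₀ (by positivity) hcoer
  refine ⟨e.symm z₀, τ, hτ, weaklyNull_iff_inner.2 fun g => ?_⟩
  have h := (hR₀ (e.symm z₀) g).sub (hz₀ g)
  rw [← he, e.apply_symm_apply, sub_self] at h
  simpa [inner_sub_left] using h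

end Hilbert

/-! ### Smooth compactly supported functions -/

section Smooth

variable {E : Type*} [NormedAddCommGroup E] [NormedSpace ℝ E]

theorem contDiff_fderiv_apply {f : E → ℝ} (hf : ContDiff ℝ ∞ f) (a : E) :
    ContDiff ℝ ∞ fun x => fderiv ℝ f x a :=
  (hf.fderiv_right (m := ∞) (by simp)).clm_apply contDiff_const

variable [FiniteDimensional ℝ E] [MeasurableSpace E] [BorelSpace E] {μ : Measure E}
  [μ.IsAddHaarMeasure]

theorem integral_fderiv_mul_eq_neg {f h : E → ℝ} (hf : ContDiff ℝ ∞ f) (hcf : HasCompactSupport f)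
    (hh : ContDiff ℝ ∞ h) (a : E) :
    ∫ x, fderiv ℝ f x a * h x ∂μ = -∫ x, f x * fderiv ℝ h x a ∂μ := by
  have h1 := contDiff_fderiv_apply hf a
  have h2 := contDiff_fderiv_apply hh a
  rw [integral_mul_fderiv_eq_neg_fderiv_mul_of_integrable, neg_neg]
  · exact (h1.continuous.mul hh.continuous).integrable_of_hasCompactSupport
      (hcf.fderiv_apply (𝕜 := ℝ) a).mul_right
  · exact (hf.continuous.mul h2.continuous).integrable_of_hasCompactSupport hcf.mul_right
  · exact (hf.continuous.mul hh.continuous).integrable_of_hasCompactSupport hcf.mul_right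
  · exact fun x _ => hf.differentiable (by simp) x
  · exact fun x _ => hh.differentiable (by simp) x

/-- Integrating by parts twice exchanges the two directions of differentiation. -/
theorem integral_fderiv_mul_fderiv_comm {f h : E → ℝ} (hf : ContDiff ℝ ∞ f)
    (hcf : HasCompactSupport f) (hh : ContDiff ℝ ∞ h) (a b : E) :
    ∫ x, fderiv ℝ f x a * fderiv ℝ h x b ∂μ = ∫ x, fderiv ℝ f x b * fderiv ℝ h x a ∂μ := by
  rw [integral_fderiv_mul_eq_neg hf hcf (contDiff_fderiv_apply hh b),
    integral_fderiv_mul_eq_neg hf hcf (contDiff_fderiv_apply hh a)]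
  congr 2
  ext x
  have hd : DifferentiableAt ℝ (fderiv ℝ h) x :=
    (hh.fderiv_right (m := ∞) (by simp)).differentiable (by simp) x
  have hs : IsSymmSndFDerivAt ℝ h x := hh.contDiffAt.isSymmSndFDerivAt (by
    simp only [minSmoothness_of_isRCLikeNormedField]
    exact WithTop.coe_le_coe.2 le_top)
  rw [fderiv_clm_apply hd (differentiableAt_const b),
    fderiv_clm_apply hd (differentiableAt_const a)]
  simp [hs.eq a b]

end Smooth

/-! ### Test fields -/

section Test

variable {U : Set E3} {w : E3 → E3}

theorem fderiv_coord (hw : ContDiff ℝ ∞ w) (i : Fin 3) (x a : E3) :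
    fderiv ℝ (fun y => w y i) x a = fderiv ℝ w x a i := by
  have hd : DifferentiableAt ℝ w x := hw.differentiable (by simp) x
  have := ((EuclideanSpace.proj (𝕜 := ℝ) i : E3 →L[ℝ] ℝ).hasFDerivAt.comp x hd.hasFDerivAt).fderiv
  have h2 : fderiv ℝ (fun y => w y i) x =
    (EuclideanSpace.proj (𝕜 := ℝ) i : E3 →L[ℝ] ℝ).comp (fderiv ℝ w x) := this
  rw [h2]; rfl

theorem gradMat_apply (w : E3 → E3) (x : E3) (ij : Fin 3 × Fin 3) :
    gradMat w x ij = fderiv ℝ w x (EuclideanSpace.single ij.2 1) ij.1 := rfl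

theorem contDiff_coord (hw : ContDiff ℝ ∞ w) (i : Fin 3) : ContDiff ℝ ∞ fun x => w x i :=
  (EuclideanSpace.proj (𝕜 := ℝ) i : E3 →L[ℝ] ℝ).contDiff.comp hw

theorem hasCompactSupport_coord (hc : HasCompactSupport w) (i : Fin 3) :
    HasCompactSupport fun x => w x i :=
  hc.comp_left (g := fun v : E3 => v i) rfl

theorem continuous_gradMat (hw : ContDiff ℝ ∞ w) : Continuous (gradMat w) := by
  refine (PiLp.continuous_toLp 2 _).comp (continuous_pi fun ij => ?_)
  exact (EuclideanSpace.proj (𝕜 := ℝ) ij.1 : E3 →L[ℝ] ℝ).continuous.comp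
    ((hw.continuous_fderiv (by simp)).clm_apply continuous_const)

theorem support_gradMat_subset (w : E3 → E3) : Function.support (gradMat w) ⊆ tsupport w := by
  intro x hx
  by_contra h
  refine hx ?_
  have : fderiv ℝ w x = 0 := by
    have := (support_fderiv_subset ℝ (f := w))
    by_contra h'
    exact h (this h')
  ext ij
  simp [gradMat_apply, this]

theorem hasCompactSupport_gradMat (hc : HasCompactSupport w) : HasCompactSupport (gradMat w) :=
  hc.of_isClosed_subset (isClosed_tsupport _)
    (closure_minimal (support_gradMat_subset w) (isClosed_tsupport _))

theorem norm_fderiv_le_gradMat (w : E3 → E3) (x : E3) : ‖fderiv ℝ w x‖ ≤ 3 * ‖gradMat w x‖ := by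
  refine ContinuousLinearMap.opNorm_le_bound _ (by positivity) fun v => ?_
  have hcol : ∀ j, ‖fderiv ℝ w x (EuclideanSpace.single j 1)‖ ≤ ‖gradMat w x‖ := by
    intro j
    rw [← sq_le_sq₀ (norm_nonneg _) (norm_nonneg _), EuclideanSpace.norm_sq_eq,
      EuclideanSpace.norm_sq_eq, Fintype.sum_prod_type]
    refine Finset.sum_le_sum fun i _ => ?_
    exact Finset.single_le_sum (f := fun j => ‖gradMat w x (i, j)‖ ^ 2)
      (fun _ _ => by positivity) (Finset.mem_univ j)
  have hv : v = ∑ j, v j • (EuclideanSpace.single j (1 : ℝ) : E3) := by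
    ext i
    simp [Finset.sum_apply, Pi.single_apply]
  calc ‖fderiv ℝ w x v‖ = ‖∑ j, v j • fderiv ℝ w x (EuclideanSpace.single j 1)‖ := by
        conv_lhs => rw [hv]
        simp
    _ ≤ ∑ j : Fin 3, ‖v‖ * ‖gradMat w x‖ := by
        refine (norm_sum_le _ _).trans (Finset.sum_le_sum fun j _ => ?_)
        rw [norm_smul]
        gcongr
        · exact PiLp.norm_apply_le v j
        · exact hcol j
    _ = 3 * ‖gradMat w x‖ * ‖v‖ := by simp; ring

theorem gradMat_add {w w' : E3 → E3} (hw : ContDiff ℝ ∞ w) (hw' : ContDiff ℝ ∞ w') (x : E3) :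
    gradMat (fun y => w y + w' y) x = gradMat w x + gradMat w' x := by
  ext ij
  simp [gradMat_apply, fderiv_fun_add (hw.differentiable (by simp) x)
    (hw'.differentiable (by simp) x)]

theorem gradMat_smul {w : E3 → E3} (hw : ContDiff ℝ ∞ w) (c : ℝ) (x : E3) :
    gradMat (fun y => c • w y) x = c • gradMat w x := by
  ext ij
  simp [gradMat_apply, fderiv_fun_const_smul (hw.differentiable (by simp) x)]

theorem span_testPairs_subset (U : Set E3) :
    (Submodule.span ℝ (testPairs U) : Set (PairSpace U)) ⊆ testPairs U := by
  intro z hz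
  induction hz using Submodule.span_induction with
  | mem z h => exact h
  | zero =>
    refine ⟨fun _ => 0, contDiff_const, HasCompactSupport.zero, ?_, Lp.coeFn_zero _ _ _, ?_⟩
    · have : tsupport (fun _ : E3 => (0 : E3)) = ∅ := tsupport_eq_empty_iff.2 rfl
      rw [this]; exact empty_subset _
    · refine (Lp.coeFn_zero _ _ _).trans (Eventually.of_forall fun x => ?_)
      ext ij
      simp [gradMat_apply]
  | add z z' _ _ h h' =>
    obtain ⟨w, h1, h2, h3, h4, h5⟩ := h
    obtain ⟨w', h1', h2', h3', h4', h5'⟩ := h'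
    refine ⟨fun x => w x + w' x, h1.add h1', h2.add h2',
      (tsupport_add w w').trans (union_subset h3 h3'), ?_, ?_⟩
    · filter_upwards [h4, h4', Lp.coeFn_add z.fst z'.fst] with x e1 e2 e3
      rw [WithLp.add_fst, e3, Pi.add_apply, e1, e2]
    · filter_upwards [h5, h5', Lp.coeFn_add z.snd z'.snd] with x e1 e2 e3
      rw [WithLp.add_snd, e3, Pi.add_apply, e1, e2, gradMat_add h1 h1']
  | smul c z _ h =>
    obtain ⟨w, h1, h2, h3, h4, h5⟩ := h
    refine ⟨fun x => c • w x, h1.const_smul c, h2.smul_left (f := fun _ => c),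
      (tsupport_smul_subset_right (fun _ => c) w).trans h3, ?_, ?_⟩
    · filter_upwards [h4, Lp.coeFn_smul c z.fst] with x e1 e3
      rw [WithLp.smul_fst, e3, Pi.smul_apply, e1]
    · filter_upwards [h5, Lp.coeFn_smul c z.snd] with x e1 e3
      rw [WithLp.smul_snd, e3, Pi.smul_apply, e1, gradMat_smul h1]

/-- A closed condition on pairs that holds for `(w, ∇w)` with `w ∈ C_c^∞(U)` holds on `H₀¹`. -/
theorem H10_induction {P : PairSpace U → Prop} (hP : IsClosed {z | P z})
    (h : ∀ (z : PairSpace U) (w : E3 → E3), ContDiff ℝ ∞ w → HasCompactSupport w →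
      tsupport w ⊆ U → z.fst =ᵐ[volU U] w → z.snd =ᵐ[volU U] gradMat w → P z)
    {z : PairSpace U} (hz : z ∈ H10 U) : P z := by
  have hz' : z ∈ closure (Submodule.span ℝ (testPairs U) : Set (PairSpace U)) := hz
  refine closure_minimal (fun y hy => ?_) hP hz'
  obtain ⟨w, h1, h2, h3, h4, h5⟩ := span_testPairs_subset U hy
  exact h y w h1 h2 h3 h4 h5

theorem norm_eq_eLpNorm {F : Type*} [NormedAddCommGroup F] {f : Lp F 2 (volU U)} {g : E3 → F}
    (h : f =ᵐ[volU U] g) (hg : Function.support g ⊆ U) :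
    ‖f‖ = (eLpNorm g 2 volume).toReal := by
  rw [Lp.norm_def, eLpNorm_congr_ae h, eLpNorm_restrict_eq_of_support_subset hg]

/-- Poincaré's inequality on `H₀¹`. -/
theorem exists_norm_fst_le (hUb : Bornology.IsBounded U) :
    ∃ C, 0 ≤ C ∧ ∀ z ∈ H10 U, ‖z.fst‖ ≤ C * ‖z.snd‖ := by
  refine ⟨eLpNormLESNormFDerivOfLeConst E3 (volume : Measure E3) U 2 2 * 3, by positivity,
    fun z hz => ?_⟩
  refine H10_induction (P := fun z => ‖z.fst‖ ≤
    eLpNormLESNormFDerivOfLeConst E3 (volume : Measure E3) U 2 2 * 3 * ‖z.snd‖) ?_ ?_ hz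
  · exact isClosed_le (WithLp.fstL 2 ℝ (L2vec U) (L2mat U)).continuous.norm
      (continuous_const.mul (WithLp.sndL 2 ℝ (L2vec U) (L2mat U)).continuous.norm)
  · intro z w h1 h2 h3 h4 h5
    have hsub : Function.support w ⊆ U := (subset_tsupport w).trans h3
    have hm : MemLp (gradMat w) 2 volume :=
      (continuous_gradMat h1).memLp_of_hasCompactSupport (hasCompactSupport_gradMat h2)
    rw [norm_eq_eLpNorm h4 hsub, norm_eq_eLpNorm h5 ((support_gradMat_subset w).trans h3)]
    have hp := eLpNorm_le_eLpNorm_fderiv (volume : Measure E3) (h1.of_le (by simp)) hsub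
      (p := 2) (by norm_num) (by simp; norm_num) hUb
    have hg : eLpNorm (fderiv ℝ w) 2 volume ≤ ENNReal.ofReal 3 * eLpNorm (gradMat w) 2 volume :=
      eLpNorm_le_mul_eLpNorm_of_ae_le_mul
        (Eventually.of_forall fun x => norm_fderiv_le_gradMat w x) 2
    have := hp.trans (mul_le_mul_right hg _)
    have h6 := ENNReal.toReal_mono (ENNReal.mul_ne_top (by simp)
      (ENNReal.mul_ne_top (by simp) hm.eLpNorm_ne_top)) this
    simpa [ENNReal.toReal_mul, mul_assoc] using h6

end Test

/-! ### Korn's inequality -/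

/-- Transposition of matrices. -/
def transposeL : M3 →L[ℝ] M3 :=
  LinearMap.toContinuousLinearMap
    { toFun := fun ξ => WithLp.toLp 2 fun ij => ξ (ij.2, ij.1)
      map_add' := fun ξ η => by ext; simp
      map_smul' := fun c ξ => by ext; simp }

@[simp] theorem transposeL_apply (ξ : M3) (ij : Fin 3 × Fin 3) :
    transposeL ξ ij = ξ (ij.2, ij.1) := rfl

/-- `symPart` as a continuous linear map. -/
def symPartL : M3 →L[ℝ] M3 := (2⁻¹ : ℝ) • (ContinuousLinearMap.id ℝ M3 + transposeL)

theorem symPartL_apply (ξ : M3) : symPartL ξ = symPart ξ := by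
  ext ij
  simp [symPartL, symPart]
  ring

theorem norm_symPart_sq (ξ : M3) :
    ‖symPart ξ‖ ^ 2 = 2⁻¹ * ‖ξ‖ ^ 2 + 2⁻¹ * inner ℝ ξ (transposeL ξ) := by
  simp only [EuclideanSpace.norm_sq_eq, PiLp.inner_apply, Fintype.sum_prod_type,
    Fin.sum_univ_three, transposeL_apply, symPart, Real.norm_eq_abs, sq_abs]
  simp
  ring

theorem norm_symPart_le (ξ : M3) : ‖symPart ξ‖ ≤ ‖ξ‖ := by
  have h1 : ‖transposeL ξ‖ ^ 2 = ‖ξ‖ ^ 2 := by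
    simp only [EuclideanSpace.norm_sq_eq, Fintype.sum_prod_type, Fin.sum_univ_three,
      transposeL_apply]
    ring
  rw [sq_eq_sq₀ (norm_nonneg _) (norm_nonneg _)] at h1
  have h2 := real_inner_le_norm ξ (transposeL ξ)
  rw [h1] at h2
  rw [← sq_le_sq₀ (norm_nonneg _) (norm_nonneg _), norm_symPart_sq]
  nlinarith

theorem traceM_apply (ξ : M3) : traceM ξ = ∑ i, ξ (i, i) := by
  simp [traceM]

/-- On `H₀¹`, `∫ ∂ⱼwᵢ ∂ᵢwⱼ = ∫ (div w)²`. -/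
theorem inner_transpose_eq_norm_div_sq {U : Set E3} {z : PairSpace U} (hz : z ∈ H10 U) :
    (inner ℝ z.snd (transposeL.compLpL 2 (volU U) z.snd) : ℝ) = ‖divL U z‖ ^ 2 := by
  have hc : Continuous fun z : PairSpace U => z.snd :=
    (WithLp.sndL 2 ℝ (L2vec U) (L2mat U)).continuous
  refine H10_induction (P := fun z => (inner ℝ z.snd (transposeL.compLpL 2 (volU U) z.snd) : ℝ) =
    ‖divL U z‖ ^ 2) ?_ ?_ hz
  · exact isClosed_eq (hc.inner ((transposeL.compLpL 2 (volU U)).continuous.comp hc))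
      ((divL U).continuous.norm.pow 2)
  · intro z w h1 h2 h3 _ h5
    have hsup : ∀ x, x ∉ U → gradMat w x = 0 := fun x hx => by
      by_contra h
      exact hx (h3 (support_gradMat_subset w h))
    have hd : (divL U z : E3 → ℝ) =ᵐ[volU U] fun x => traceM (gradMat w x) := by
      refine (ContinuousLinearMap.coeFn_compLpL traceM z.snd).trans ?_
      filter_upwards [h5] with x hx
      rw [hx]
    have e1 : (inner ℝ z.snd (transposeL.compLpL 2 (volU U) z.snd) : ℝ) =
        ∫ x, inner ℝ (gradMat w x) (transposeL (gradMat w x)) := by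
      rw [L2.inner_def]
      rw [← setIntegral_eq_integral_of_forall_compl_eq_zero (s := U)
        (f := fun x => inner ℝ (gradMat w x) (transposeL (gradMat w x)))
        fun x hx => by rw [hsup x hx, inner_zero_left]]
      refine integral_congr_ae ?_
      filter_upwards [h5, ContinuousLinearMap.coeFn_compLpL transposeL z.snd] with x hx hx'
      rw [hx', hx]
    have e2 : ‖divL U z‖ ^ 2 = ∫ x, traceM (gradMat w x) * traceM (gradMat w x) := by
      rw [← real_inner_self_eq_norm_sq, L2.inner_def]
      rw [← setIntegral_eq_integral_of_forall_compl_eq_zero (s := U)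
        (f := fun x => traceM (gradMat w x) * traceM (gradMat w x))
        fun x hx => by rw [hsup x hx, map_zero, mul_zero]]
      refine integral_congr_ae ?_
      filter_upwards [hd] with x hx
      rw [hx]
      simp [pow_two]
    have hint : ∀ (i j k l : Fin 3), Integrable fun x =>
        fderiv ℝ (fun y => w y i) x (EuclideanSpace.single j (1 : ℝ)) *
          fderiv ℝ (fun y => w y k) x (EuclideanSpace.single l (1 : ℝ)) := by
      intro i j k l
      refine ((contDiff_fderiv_apply (contDiff_coord h1 i) _).continuous.mul
        (contDiff_fderiv_apply (contDiff_coord h1 k) _).continuous).integrable_of_hasCompactSupport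
          ?_
      exact ((hasCompactSupport_coord h2 i).fderiv_apply (𝕜 := ℝ) _).mul_right
    rw [e1, e2]
    have f1 : ∀ x, (inner ℝ (gradMat w x) (transposeL (gradMat w x)) : ℝ) =
        ∑ i : Fin 3, ∑ j : Fin 3, fderiv ℝ (fun y => w y i) x (EuclideanSpace.single j (1 : ℝ)) *
          fderiv ℝ (fun y => w y j) x (EuclideanSpace.single i (1 : ℝ)) := by
      intro x
      simp only [PiLp.inner_apply, Fintype.sum_prod_type, transposeL_apply, gradMat_apply,
        fderiv_coord h1]
      simp [mul_comm]
    have f2 : ∀ x, traceM (gradMat w x) * traceM (gradMat w x) =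
        ∑ i : Fin 3, ∑ j : Fin 3, fderiv ℝ (fun y => w y i) x (EuclideanSpace.single i (1 : ℝ)) *
          fderiv ℝ (fun y => w y j) x (EuclideanSpace.single j (1 : ℝ)) := by
      intro x
      rw [traceM_apply, Finset.sum_mul_sum]
      simp only [gradMat_apply, fderiv_coord h1]
    simp_rw [f1, f2]
    rw [integral_finsetSum _ fun i _ => integrable_finsetSum _ fun j _ => hint i j j i,
      integral_finsetSum _ fun i _ => integrable_finsetSum _ fun j _ => hint i i j j]
    refine Finset.sum_congr rfl fun i _ => ?_
    rw [integral_finsetSum _ fun j _ => hint i j j i, integral_finsetSum _ fun j _ => hint i i j j]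
    refine Finset.sum_congr rfl fun j _ => ?_
    exact integral_fderiv_mul_fderiv_comm (contDiff_coord h1 i) (hasCompactSupport_coord h2 i)
      (contDiff_coord h1 j) _ _

/-! ### The Hilbert space `V` and the operators of the two-phase material -/

section Operators

instance : Fact ((2 : ENNReal) ≠ ⊤) := ⟨ENNReal.ofNat_ne_top⟩

instance separableSpace_V (U : Set E3) : TopologicalSpace.SeparableSpace (V U) := by
  have : SecondCountableTopology (L2vec U) := inferInstance
  have : SecondCountableTopology (L2mat U) := inferInstance
  have : SecondCountableTopology (PairSpace U) :=
    (WithLp.homeomorphProd 2 (L2vec U) (L2mat U)).secondCountableTopology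
  infer_instance

instance completeSpace_V (U : Set E3) : CompleteSpace (V U) := by
  have h1 : IsClosed (H10 U : Set (PairSpace U)) := Submodule.isClosed_topologicalClosure _
  have h2 : IsClosed ((divL U).toLinearMap.ker : Set (PairSpace U)) := (divL U).isClosed_ker
  exact (h1.inter h2).completeSpace_coe

instance separableSpace_VT (U : Set E3) (T : ℝ) : TopologicalSpace.SeparableSpace (VT U T) := by
  have : SecondCountableTopology (VT U T) := inferInstance
  infer_instance

variable {U : Set E3}

/-- `v ↦ e(v)` as a continuous linear map. -/
def strainL (U : Set E3) : V U →L[ℝ] L2mat U :=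
  ((symPartL.compLpL 2 (volU U)).comp (WithLp.sndL 2 ℝ (L2vec U) (L2mat U))).comp (V U).subtypeL

theorem coeFn_strainL (v : V U) : strainL U v =ᵐ[volU U] strain v := by
  refine (ContinuousLinearMap.coeFn_compLpL symPartL (grad v)).trans ?_
  exact Eventually.of_forall fun x => symPartL_apply _

theorem norm_strainL_le (v : V U) : ‖strainL U v‖ ≤ ‖v‖ := by
  have h1 : ‖strainL U v‖ ≤ ‖grad v‖ := Lp.norm_le_norm_of_ae_le (by
    filter_upwards [coeFn_strainL v] with x hx
    rw [hx]
    exact norm_symPart_le _)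
  have h2 := WithLp.prod_norm_sq_eq_of_L2 (v : PairSpace U)
  refine h1.trans ?_
  rw [← sq_le_sq₀ (norm_nonneg _) (norm_nonneg _), ← Submodule.norm_coe, h2]
  exact le_add_of_nonneg_left (sq_nonneg _)

theorem norm_strainL_sq (v : V U) : ‖strainL U v‖ ^ 2 = 2⁻¹ * ‖grad v‖ ^ 2 := by
  have hd : divL U v = 0 := v.2.2
  have hk := inner_transpose_eq_norm_div_sq v.2.1
  rw [hd, norm_zero] at hk
  have hn : strainL U v = (2⁻¹ : ℝ) • (grad v + transposeL.compLpL 2 (volU U) (grad v)) := by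
    refine Lp.ext ?_
    refine (ContinuousLinearMap.coeFn_compLpL symPartL (grad v)).trans ?_
    filter_upwards [Lp.coeFn_smul (2⁻¹ : ℝ) (grad v + transposeL.compLpL 2 (volU U) (grad v)),
      Lp.coeFn_add (grad v) (transposeL.compLpL 2 (volU U) (grad v)),
      ContinuousLinearMap.coeFn_compLpL transposeL (grad v)] with x h1 h2 h3
    rw [h1, Pi.smul_apply, h2, Pi.add_apply, h3]
    rfl
  have hs : (inner ℝ (strainL U v) (strainL U v) : ℝ) = inner ℝ (strainL U v) (grad v) := by
    rw [L2.inner_def, L2.inner_def]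
    refine integral_congr_ae ?_
    filter_upwards [ContinuousLinearMap.coeFn_compLpL symPartL (grad v)] with x hx
    have hx' : strainL U v x = symPartL (grad v x) := hx
    rw [hx', real_inner_self_eq_norm_sq, symPartL_apply, norm_symPart_sq, ← symPartL_apply,
      symPartL, smul_apply, add_apply,
      ContinuousLinearMap.id_apply, real_inner_smul_left, inner_add_left,
      real_inner_self_eq_norm_sq, real_inner_comm, mul_add]
  rw [← real_inner_self_eq_norm_sq, hs, hn, real_inner_smul_left, inner_add_left,
    real_inner_self_eq_norm_sq, real_inner_comm, show grad v = (v : PairSpace U).snd from rfl, hk]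
  simp

/-- Korn's and Poincaré's inequalities: `c ‖v‖² ≤ ‖e(v)‖²` on `V`. -/
theorem exists_coercive_strainL (hUb : Bornology.IsBounded U) :
    ∃ c, 0 < c ∧ ∀ v : V U, c * ‖v‖ ^ 2 ≤ ‖strainL U v‖ ^ 2 := by
  obtain ⟨C, hC, h⟩ := exists_norm_fst_le hUb
  refine ⟨(2 * (C ^ 2 + 1))⁻¹, by positivity, fun v => ?_⟩
  have h1 := WithLp.prod_norm_sq_eq_of_L2 (v : PairSpace U)
  have h2 := h v v.2.1
  have h3 : ‖(v : PairSpace U).fst‖ ^ 2 ≤ C ^ 2 * ‖grad v‖ ^ 2 := by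
    rw [← mul_pow]
    gcongr
    exact h2
  have h4 : ‖v‖ ^ 2 = ‖(v : PairSpace U).fst‖ ^ 2 + ‖grad v‖ ^ 2 := h1
  rw [norm_strainL_sq, inv_mul_le_iff₀ (by positivity), h4]
  nlinarith

section Modulus

variable {S : Set E3} {c₁ c₂ : ℝ}

theorem abs_modulus_le (h₁ : 0 < c₁) (h₂ : 0 < c₂) (x : E3) : |modulus S c₁ c₂ x| ≤ max c₁ c₂ := by
  unfold modulus
  split_ifs
  · rw [abs_of_pos h₁]; exact le_max_left _ _
  · rw [abs_of_pos h₂]; exact le_max_right _ _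

theorem le_modulus (x : E3) : min c₁ c₂ ≤ modulus S c₁ c₂ x := by
  unfold modulus
  split_ifs
  · exact min_le_left _ _
  · exact min_le_right _ _

theorem measurable_modulus (hS : MeasurableSet S) : Measurable (modulus S c₁ c₂) :=
  Measurable.ite hS measurable_const measurable_const

theorem memLp_modulus (hS : MeasurableSet S) : MemLp (modulus S c₁ c₂) ⊤ (volU U) := by
  refine memLp_top_of_bound (measurable_modulus hS).aestronglyMeasurable (max |c₁| |c₂|)
    (Eventually.of_forall fun x => ?_)
  unfold modulus
  split_ifs
  · exact le_max_left _ _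
  · exact le_max_right _ _

/-- Multiplication of a matrix field by the two-phase modulus. -/
def tensorL (U : Set E3) (c₁ c₂ : ℝ) (hS : MeasurableSet S) : L2mat U →L[ℝ] L2mat U :=
  (ContinuousLinearMap.lsmul ℝ ℝ : ℝ →L[ℝ] M3 →L[ℝ] M3).holderL (volU U) ⊤ 2 2
    ((memLp_modulus hS : MemLp (modulus S c₁ c₂) ⊤ (volU U)).toLp _)

theorem coeFn_tensorL (hS : MeasurableSet S) (g : L2mat U) :
    tensorL U c₁ c₂ hS g =ᵐ[volU U] fun x => tensor S c₁ c₂ x (g x) := by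
  refine (ContinuousLinearMap.coeFn_holder _ _ g).trans ?_
  filter_upwards [MemLp.coeFn_toLp (memLp_modulus hS : MemLp (modulus S c₁ c₂) ⊤ (volU U))]
    with x hx
  rw [hx]
  rfl

theorem norm_tensorL_le (h₁ : 0 < c₁) (h₂ : 0 < c₂) (hS : MeasurableSet S) (g : L2mat U) :
    ‖tensorL U c₁ c₂ hS g‖ ≤ max c₁ c₂ * ‖g‖ := by
  refine Lp.norm_le_mul_norm_of_ae_le_mul ?_
  filter_upwards [coeFn_tensorL hS g] with x hx
  rw [hx, tensor, norm_smul]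
  gcongr
  exact abs_modulus_le h₁ h₂ x

theorem inner_tensorL_comm (hS : MeasurableSet S) (g h : L2mat U) :
    (inner ℝ (tensorL U c₁ c₂ hS g) h : ℝ) = inner ℝ (tensorL U c₁ c₂ hS h) g := by
  rw [L2.inner_def, L2.inner_def]
  refine integral_congr_ae ?_
  filter_upwards [coeFn_tensorL hS g, coeFn_tensorL hS h] with x hx hx'
  rw [hx, hx', tensor, tensor, real_inner_smul_left, real_inner_smul_left, real_inner_comm]

theorem le_inner_tensorL (hS : MeasurableSet S) (g : L2mat U) :
    min c₁ c₂ * ‖g‖ ^ 2 ≤ inner ℝ (tensorL U c₁ c₂ hS g) g := by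
  rw [← real_inner_self_eq_norm_sq, ← real_inner_smul_left, L2.inner_def, L2.inner_def]
  refine integral_mono_ae (L2.integrable_inner _ _) (L2.integrable_inner _ _) ?_
  filter_upwards [coeFn_tensorL (c₁ := c₁) (c₂ := c₂) hS g, Lp.coeFn_smul (min c₁ c₂) g]
    with x hx hx'
  rw [hx, hx', tensor, Pi.smul_apply, real_inner_smul_left, real_inner_smul_left]
  exact mul_le_mul_of_nonneg_right (le_modulus x) real_inner_self_nonneg

/-- The operator of the bilinear form `∫ A e(v) · e(w)` on `V`. -/
def stiffness (U : Set E3) (c₁ c₂ : ℝ) (hS : MeasurableSet S) : V U →L[ℝ] V U :=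
  (strainL U).adjoint.comp ((tensorL U c₁ c₂ hS).comp (strainL U))

theorem inner_stiffness (hS : MeasurableSet S) (v w : V U) :
    (inner ℝ (stiffness U c₁ c₂ hS v) w : ℝ) =
      inner ℝ (tensorL U c₁ c₂ hS (strainL U v)) (strainL U w) := by
  simp [stiffness, ContinuousLinearMap.adjoint_inner_left]

theorem inner_stiffness_comm (hS : MeasurableSet S) (v w : V U) :
    (inner ℝ (stiffness U c₁ c₂ hS v) w : ℝ) = inner ℝ (stiffness U c₁ c₂ hS w) v := by
  rw [inner_stiffness, inner_stiffness, inner_tensorL_comm]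

theorem norm_adjoint_strainL_le (g : L2mat U) : ‖(strainL U).adjoint g‖ ≤ ‖g‖ := by
  have h : ‖(strainL U).adjoint‖ ≤ 1 := by
    rw [LinearIsometryEquiv.norm_map]
    exact ContinuousLinearMap.opNorm_le_bound _ zero_le_one fun v => by
      simpa using norm_strainL_le v
  simpa using (strainL U).adjoint.le_of_opNorm_le h g

theorem norm_stiffness_le (h₁ : 0 < c₁) (h₂ : 0 < c₂) (hS : MeasurableSet S) (v : V U) :
    ‖stiffness U c₁ c₂ hS v‖ ≤ max c₁ c₂ * ‖v‖ :=
  (norm_adjoint_strainL_le _).trans <| (norm_tensorL_le h₁ h₂ hS _).trans <| by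
    gcongr
    exact norm_strainL_le v

theorem le_inner_stiffness (h₁ : 0 < c₁) (h₂ : 0 < c₂) (hS : MeasurableSet S) {c : ℝ}
    (hc : ∀ v : V U, c * ‖v‖ ^ 2 ≤ ‖strainL U v‖ ^ 2) (v : V U) :
    min c₁ c₂ * c * ‖v‖ ^ 2 ≤ inner ℝ (stiffness U c₁ c₂ hS v) v := by
  rw [inner_stiffness, mul_assoc]
  refine le_trans ?_ (le_inner_tensorL hS _)
  have := lt_min h₁ h₂
  gcongr
  exact hc v

/-- A matrix field `G` enters the weak formulation through the functional
`w ↦ ∫ A G · e(w)`, whose Riesz representative is `e† (A G)`. -/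
theorem integral_tensor_strain (hS : MeasurableSet S) (g : L2mat U) {G : E3 → M3}
    (hg : g =ᵐ[volU U] G) (w : V U) :
    ∫ x in U, inner ℝ (tensor S c₁ c₂ x (G x)) (strain w x) =
      inner ℝ ((strainL U).adjoint (tensorL U c₁ c₂ hS g)) w := by
  rw [ContinuousLinearMap.adjoint_inner_left, L2.inner_def]
  refine integral_congr_ae ?_
  filter_upwards [hg, coeFn_tensorL hS g, coeFn_strainL w] with x h1 h2 h3
  rw [h2, h3, h1]

end Modulus

end Operators

/-! ### Rellich's theorem -/

section Rellich

open FourierTransform LineDeriv in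
/-- The part of the `L²` norm carried by frequencies above `R` is controlled by the gradient. -/
theorem integral_sq_le_low_frequencies {f : E3 → ℝ} (hf : ContDiff ℝ ∞ f)
    (hc : HasCompactSupport f) {R : ℝ} (hR : 0 < R) :
    ∫ x, ‖f x‖ ^ 2 ≤ (∫ ξ in Metric.ball (0 : E3) R, ‖𝓕 (fun x => (f x : ℂ)) ξ‖ ^ 2) +
      (R ^ 2)⁻¹ * ∑ j : Fin 3, ∫ x, ‖fderiv ℝ f x (EuclideanSpace.single j 1)‖ ^ 2 := by
  have hcF : HasCompactSupport fun x => (f x : ℂ) := hc.comp_left (g := ((↑) : ℝ → ℂ)) rfl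
  have hdF : ContDiff ℝ ∞ fun x => (f x : ℂ) := Complex.ofRealCLM.contDiff.comp hf
  let F : SchwartzMap E3 ℂ := hcF.toSchwartzMap hdF
  have hint : ∀ G : SchwartzMap E3 ℂ, Integrable fun ξ => ‖G ξ‖ ^ 2 := fun G =>
    (G.memLp 2 volume).integrable_norm_pow (by norm_num)
  have h1 : ∫ x, ‖f x‖ ^ 2 = ∫ ξ, ‖(𝓕 F) ξ‖ ^ 2 := by
    rw [SchwartzMap.integral_norm_sq_fourier]
    refine integral_congr_ae (Eventually.of_forall fun x => ?_)
    simp [F]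
  have hder : ∀ j : Fin 3, ∀ ξ : E3, ‖(𝓕 (∂_{(EuclideanSpace.single j (1 : ℝ) : E3)} F)) ξ‖ ^ 2 =
      (2 * Real.pi) ^ 2 * (ξ j ^ 2 * ‖(𝓕 F) ξ‖ ^ 2) := by
    intro j ξ
    rw [SchwartzMap.fourier_lineDerivOp_eq]
    have : (fun x : E3 => (inner ℝ x (EuclideanSpace.single j (1 : ℝ)) : ℝ)).HasTemperateGrowth :=
      ((innerSL ℝ).flip (EuclideanSpace.single j (1 : ℝ) : E3)).hasTemperateGrowth
    rw [smul_apply, SchwartzMap.smulLeftCLM_apply_apply this]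
    have hin : (inner ℝ ξ (EuclideanSpace.single j (1 : ℝ)) : ℝ) = ξ j := by
      simp [EuclideanSpace.inner_single_right]
    rw [hin, norm_smul, norm_smul, mul_pow, mul_pow]
    simp [abs_of_pos Real.pi_pos]
  have h2 : ∀ j : Fin 3, ∫ x, ‖fderiv ℝ f x (EuclideanSpace.single j 1)‖ ^ 2 =
      ∫ ξ, (2 * Real.pi) ^ 2 * (ξ j ^ 2 * ‖(𝓕 F) ξ‖ ^ 2) := by
    intro j
    simp_rw [← hder j]
    rw [SchwartzMap.integral_norm_sq_fourier]
    refine integral_congr_ae (Eventually.of_forall fun x => ?_)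
    have hd : fderiv ℝ (fun x => (f x : ℂ)) x = Complex.ofRealCLM.comp (fderiv ℝ f x) :=
      (Complex.ofRealCLM.hasFDerivAt.comp x (hf.differentiable (by simp) x).hasFDerivAt).fderiv
    have : (∂_{(EuclideanSpace.single j (1 : ℝ) : E3)} F) x =
        fderiv ℝ (fun x => (f x : ℂ)) x (EuclideanSpace.single j 1) := rfl
    simp only [this, hd]
    simp
  have hint2 : ∀ j : Fin 3, Integrable fun ξ : E3 =>
      (2 * Real.pi) ^ 2 * (ξ j ^ 2 * ‖(𝓕 F) ξ‖ ^ 2) := fun j => by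
    simp_rw [← hder j]
    exact hint _
  have h3 : ∫ ξ in (Metric.ball (0 : E3) R)ᶜ, ‖(𝓕 F) ξ‖ ^ 2 ≤
      (R ^ 2)⁻¹ * ∑ j : Fin 3, ∫ x, ‖fderiv ℝ f x (EuclideanSpace.single j 1)‖ ^ 2 := by
    simp_rw [h2]
    rw [← integral_finsetSum _ fun j _ => hint2 j, ← integral_const_mul]
    have hint3 : Integrable fun ξ : E3 => (R ^ 2)⁻¹ *
        ∑ j : Fin 3, (2 * Real.pi) ^ 2 * (ξ j ^ 2 * ‖(𝓕 F) ξ‖ ^ 2) :=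
      (integrable_finsetSum _ fun j _ => hint2 j).const_mul _
    refine (setIntegral_mono_on (hint _).integrableOn hint3.integrableOn
      Metric.isOpen_ball.measurableSet.compl fun ξ hξ => ?_).trans
      (setIntegral_le_integral hint3 (Eventually.of_forall fun ξ => by
        simp only [Pi.zero_apply]; positivity))
    have hξ' : R ≤ ‖ξ‖ := by simpa using hξ
    have h4 : ∑ j : Fin 3, (2 * Real.pi) ^ 2 * (ξ j ^ 2 * ‖(𝓕 F) ξ‖ ^ 2) =
        (2 * Real.pi) ^ 2 * ‖ξ‖ ^ 2 * ‖(𝓕 F) ξ‖ ^ 2 := by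
      rw [EuclideanSpace.norm_sq_eq, ← Finset.mul_sum, ← Finset.sum_mul, mul_assoc]
      simp
    rw [h4, le_inv_mul_iff₀ (by positivity)]
    have h5 : R ^ 2 ≤ ‖ξ‖ ^ 2 := by gcongr
    have h6 : 1 ≤ (2 * Real.pi) ^ 2 := by nlinarith [Real.pi_gt_three]
    have h7 : R ^ 2 ≤ (2 * Real.pi) ^ 2 * ‖ξ‖ ^ 2 := by nlinarith [sq_nonneg ‖ξ‖]
    gcongr
  rw [h1, ← integral_add_compl Metric.isOpen_ball.measurableSet (hint (𝓕 F))]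
  refine add_le_add (le_of_eq ?_) h3
  rfl

variable {U : Set E3}

/-- The Fourier transform at `ξ` of a component is a bounded functional on `L²(U)`, with a bound
that does not depend on `ξ`. -/
theorem exists_fourier_functional (hUb : Bornology.IsBounded U) :
    ∃ C : ℝ, ∀ (i : Fin 3) (ξ : E3), ∃ l : L2vec U →L[ℝ] ℂ, (∀ u, ‖l u‖ ≤ C * ‖u‖) ∧
      ∀ (u : L2vec U) (w : E3 → E3), u =ᵐ[volU U] w → Function.support w ⊆ U →
        l u = FourierTransform.fourier (fun x => (w x i : ℂ)) ξ := by
  have hfin : IsFiniteMeasure (volU U) := ⟨by simpa using hUb.measure_lt_top⟩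
  refine ⟨measureUnivNNReal (volU U) ^ (ENNReal.toReal 2)⁻¹ * 1, fun i ξ => ?_⟩
  have hm : MemLp (fun x : E3 => Complex.exp ((2 * Real.pi * inner ℝ x ξ : ℝ) * Complex.I)) 2
      (volU U) :=
    MemLp.of_bound (Continuous.aestronglyMeasurable (by fun_prop)) 1
      (Eventually.of_forall fun x => (Complex.norm_exp_ofReal_mul_I _).le)
  let Φ : L2vec U →L[ℝ] Lp ℂ 2 (volU U) :=
    (Complex.ofRealCLM.comp (EuclideanSpace.proj (𝕜 := ℝ) i : E3 →L[ℝ] ℝ)).compLpL 2 (volU U)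
  have hΦ : ∀ u, Φ u =ᵐ[volU U] fun x => (u x i : ℂ) := fun u =>
    ContinuousLinearMap.coeFn_compLpL _ u
  refine ⟨((innerSL ℂ (hm.toLp _)).restrictScalars ℝ).comp Φ, fun u => ?_, fun u w hu hw => ?_⟩
  · refine (norm_inner_le_norm (𝕜 := ℂ) (hm.toLp _) (Φ u)).trans ?_
    have h1 : ‖Φ u‖ ≤ ‖u‖ := Lp.norm_le_norm_of_ae_le (by
      filter_upwards [hΦ u] with x hx
      rw [hx, Complex.norm_real]
      exact PiLp.norm_apply_le _ i)
    have h2 : ‖hm.toLp _‖ ≤ measureUnivNNReal (volU U) ^ (ENNReal.toReal 2)⁻¹ * 1 :=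
      Lp.norm_le_of_ae_bound zero_le_one (by
        filter_upwards [hm.coeFn_toLp] with x hx
        rw [hx]
        exact (Complex.norm_exp_ofReal_mul_I _).le)
    gcongr
  · change inner ℂ (hm.toLp _) (Φ u) = _
    rw [L2.inner_def, Real.fourier_eq',
      ← setIntegral_eq_integral_of_forall_compl_eq_zero (s := U)
        (f := fun x => Complex.exp ((-2 * Real.pi * inner ℝ x ξ : ℝ) * Complex.I) • (w x i : ℂ))
        fun x hx => by
          have : w x = 0 := by
            by_contra h
            exact hx (hw h)
          simp [this]]
    refine integral_congr_ae ?_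
    filter_upwards [hm.coeFn_toLp, hΦ u, hu] with x h1 h2 h3
    rw [h1, h2, h3, smul_eq_mul, RCLike.inner_apply', ← Complex.exp_conj,
      map_mul, Complex.conj_ofReal, Complex.conj_I]
    simp

theorem norm_sq_eq_sum_integral {ι : Type*} [Fintype ι] {f : Lp (EuclideanSpace ℝ ι) 2 (volU U)}
    {g : E3 → EuclideanSpace ℝ ι} (h : f =ᵐ[volU U] g) (hg : Function.support g ⊆ U)
    (hc : Continuous g) (hcs : HasCompactSupport g) :
    ‖f‖ ^ 2 = ∑ i, ∫ x, ‖g x i‖ ^ 2 := by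
  have hint : ∀ i, Integrable fun x => ‖g x i‖ ^ 2 := by
    intro i
    have hci : Continuous fun x => g x i :=
      (EuclideanSpace.proj (𝕜 := ℝ) i : EuclideanSpace ℝ ι →L[ℝ] ℝ).continuous.comp hc
    have hcs' : HasCompactSupport fun x => g x i :=
      hcs.comp_left (g := fun v : EuclideanSpace ℝ ι => v i) rfl
    have hcs2 : HasCompactSupport fun x => ‖g x i‖ ^ 2 :=
      hcs'.comp_left (g := fun r : ℝ => ‖r‖ ^ 2) (by simp)
    exact (hci.norm.pow 2).integrable_of_hasCompactSupport hcs2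
  rw [← real_inner_self_eq_norm_sq, L2.inner_def, ← integral_finsetSum _ fun i _ => hint i,
    ← setIntegral_eq_integral_of_forall_compl_eq_zero (s := U) (f := fun x => ∑ i, ‖g x i‖ ^ 2)
      fun x hx => by
        have : g x = 0 := by
          by_contra h
          exact hx (hg h)
        simp [this]]
  refine integral_congr_ae ?_
  filter_upwards [h] with x hx
  rw [hx, real_inner_self_eq_norm_sq, EuclideanSpace.norm_sq_eq]

theorem norm_fst_sq_le_low_frequencies {z : PairSpace U} {w : E3 → E3} (h1 : ContDiff ℝ ∞ w)
    (h2 : HasCompactSupport w) (h3 : tsupport w ⊆ U) (h4 : z.fst =ᵐ[volU U] w)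
    (h5 : z.snd =ᵐ[volU U] gradMat w) {R : ℝ} (hR : 0 < R) :
    ‖z.fst‖ ^ 2 ≤ (∑ i : Fin 3, ∫ ξ in Metric.ball (0 : E3) R,
      ‖FourierTransform.fourier (fun x => (w x i : ℂ)) ξ‖ ^ 2) + (R ^ 2)⁻¹ * ‖z.snd‖ ^ 2 := by
  rw [norm_sq_eq_sum_integral h4 ((subset_tsupport w).trans h3) h1.continuous h2,
    norm_sq_eq_sum_integral h5 ((support_gradMat_subset w).trans h3) (continuous_gradMat h1)
      (hasCompactSupport_gradMat h2), Fintype.sum_prod_type, Finset.mul_sum,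
    ← Finset.sum_add_distrib]
  refine Finset.sum_le_sum fun i _ => ?_
  have := integral_sq_le_low_frequencies (contDiff_coord h1 i) (hasCompactSupport_coord h2 i) hR
  simpa only [fderiv_coord h1, gradMat_apply] using this

/-- Rellich's theorem: the inclusion `V → L²(U)` maps weakly null sequences to null sequences. -/
theorem WeaklyNull.tendsto_toL2 (hUb : Bornology.IsBounded U) {v : ℕ → V U} (hv : WeaklyNull v) :
    Tendsto (fun k => toL2 U (v k)) atTop (𝓝 0) := by
  obtain ⟨M, hM⟩ := hv.exists_norm_le
  -- replace `v k` by test fields `w k`, up to an error that tends to zero in norm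
  have hex : ∀ k : ℕ, ∃ z : PairSpace U, z ∈ testPairs U ∧
      ‖z - (v k : PairSpace U)‖ < 1 / ((k : ℝ) + 1) := by
    intro k
    have hmem : (v k : PairSpace U) ∈
        closure (Submodule.span ℝ (testPairs U) : Set (PairSpace U)) :=
      (v k).2.1
    obtain ⟨z, hz, hd⟩ := Metric.mem_closure_iff.1 hmem (1 / ((k : ℝ) + 1)) (by positivity)
    exact ⟨z, span_testPairs_subset U hz, by rwa [dist_comm, dist_eq_norm] at hd⟩
  choose z hz hzv using hex
  choose w h1 h2 h3 h4 h5 using hz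
  have herr : Tendsto (fun k => z k - (v k : PairSpace U)) atTop (𝓝 0) :=
    squeeze_zero_norm (fun k => (hzv k).le) tendsto_one_div_add_atTop_nhds_zero_nat
  have hznull : WeaklyNull z := by
    have hd : WeaklyNull fun k => z k - (v k : PairSpace U) :=
      weaklyNull_iff.2 fun l => by
        simpa [Function.comp_def] using (l.continuous.tendsto 0).comp herr
    simpa using hd.add (hv.map (V U).subtypeL)
  have hzM : ∀ k, ‖z k‖ ≤ M + 1 := by
    intro k
    have e1 : (1 : ℝ) / ((k : ℝ) + 1) ≤ 1 := by
      rw [div_le_one (by positivity)]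
      linarith [(Nat.cast_nonneg k : (0 : ℝ) ≤ k)]
    have e2 : ‖z k‖ ≤ ‖z k - (v k : PairSpace U)‖ + ‖(v k : PairSpace U)‖ := by
      simpa using norm_add_le (z k - (v k : PairSpace U)) (v k : PairSpace U)
    have e3 : ‖(v k : PairSpace U)‖ ≤ M := hM k
    linarith [hzv k]
  have hsplit : ∀ k, ‖(z k).fst‖ ≤ ‖z k‖ ∧ ‖(z k).snd‖ ≤ ‖z k‖ := by
    intro k
    have := WithLp.prod_norm_sq_eq_of_L2 (z k)
    constructor <;> rw [← sq_le_sq₀ (norm_nonneg _) (norm_nonneg _)] <;>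
      nlinarith [sq_nonneg ‖(z k).fst‖, sq_nonneg ‖(z k).snd‖]
  obtain ⟨C, hC⟩ := exists_fourier_functional hUb
  choose l hl hlw using hC
  have hlow : ∀ R : ℝ, Tendsto (fun k => ∑ i : Fin 3, ∫ ξ in Metric.ball (0 : E3) R,
      ‖FourierTransform.fourier (fun x => (w k x i : ℂ)) ξ‖ ^ 2) atTop (𝓝 0) := by
    intro R
    rw [← Finset.sum_const_zero (s := (Finset.univ : Finset (Fin 3))) (M := ℝ)]
    refine tendsto_finsetSum _ fun i _ => ?_
    have hval : ∀ k ξ, FourierTransform.fourier (fun x => (w k x i : ℂ)) ξ = l i ξ (z k).fst :=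
      fun k ξ => (hlw i ξ _ _ (h4 k) ((subset_tsupport _).trans (h3 k))).symm
    have hlim := tendsto_integral_of_dominated_convergence
      (μ := volume.restrict (Metric.ball (0 : E3) R))
      (F := fun k ξ => ‖FourierTransform.fourier (fun x => (w k x i : ℂ)) ξ‖ ^ 2) (f := fun _ => 0)
      (fun _ => (|C| * (M + 1)) ^ 2) ?_ ?_ ?_ ?_
    · simpa using hlim
    · intro k
      have hcF : HasCompactSupport fun x => (w k x i : ℂ) :=
        (hasCompactSupport_coord (h2 k) i).comp_left (g := ((↑) : ℝ → ℂ)) rfl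
      have hdF : ContDiff ℝ ∞ fun x => (w k x i : ℂ) :=
        Complex.ofRealCLM.contDiff.comp (contDiff_coord (h1 k) i)
      have : Continuous (FourierTransform.fourier (fun x => (w k x i : ℂ))) :=
        (FourierTransform.fourier (hcF.toSchwartzMap hdF)).continuous
      exact (this.norm.pow 2).aestronglyMeasurable
    · have : IsFiniteMeasure (volume.restrict (Metric.ball (0 : E3) R)) :=
        ⟨by
          rw [Measure.restrict_apply_univ]
          exact Metric.isBounded_ball.measure_lt_top⟩
      exact integrable_const _
    · refine fun k => Eventually.of_forall fun ξ => ?_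
      rw [hval, norm_pow, norm_norm]
      gcongr
      refine (hl i ξ _).trans ?_
      gcongr
      · exact le_abs_self C
      · exact (hsplit k).1.trans (hzM k)
    · refine Eventually.of_forall fun ξ => ?_
      have hnull := hznull.map ((l i ξ).comp (WithLp.fstL 2 ℝ (L2vec U) (L2mat U)))
      have hre := weaklyNull_iff.1 hnull Complex.reCLM
      have him := weaklyNull_iff.1 hnull Complex.imCLM
      have : Tendsto (fun k => (l i ξ (z k).fst).re ^ 2 + (l i ξ (z k).fst).im ^ 2)
          atTop (𝓝 0) := by
        simpa using (hre.pow 2).add (him.pow 2)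
      refine this.congr fun k => ?_
      rw [hval, Complex.sq_norm, Complex.normSq_apply]
      ring
  have hfst : Tendsto (fun k => (z k).fst) atTop (𝓝 0) := by
    have hsq : Tendsto (fun k => ‖(z k).fst‖ ^ 2) atTop (𝓝 0) := by
      rw [Metric.tendsto_atTop]
      intro ε hε
      obtain ⟨R, hR, hRε⟩ : ∃ R : ℝ, 0 < R ∧ (R ^ 2)⁻¹ * (M + 1) ^ 2 ≤ ε / 2 := by
        refine ⟨Real.sqrt (2 * ((M + 1) ^ 2 + 1) / ε), by positivity, ?_⟩
        rw [Real.sq_sqrt (by positivity), inv_div, div_mul_eq_mul_div, div_le_iff₀ (by positivity)]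
        nlinarith [sq_nonneg (M + 1)]
      obtain ⟨N, hN⟩ := Metric.tendsto_atTop.1 (hlow R) (ε / 2) (by positivity)
      refine ⟨N, fun k hk => ?_⟩
      have e1 := norm_fst_sq_le_low_frequencies (h1 k) (h2 k) (h3 k) (h4 k) (h5 k) hR
      have e2 : (R ^ 2)⁻¹ * ‖(z k).snd‖ ^ 2 ≤ (R ^ 2)⁻¹ * (M + 1) ^ 2 := by
        gcongr
        exact (hsplit k).2.trans (hzM k)
      have e3 := (abs_lt.1 (by simpa [Real.dist_eq] using hN k hk)).2
      rw [Real.dist_eq, sub_zero, abs_of_nonneg (by positivity)]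
      linarith
    have h0 := hsq.sqrt
    simp only [Real.sqrt_sq (norm_nonneg _), Real.sqrt_zero] at h0
    exact tendsto_zero_iff_norm_tendsto_zero.2 h0
  have h6 := ((WithLp.fstL 2 ℝ (L2vec U) (L2mat U)).continuous.tendsto 0).comp herr
  rw [map_zero] at h6
  have h7 := hfst.sub h6
  rw [sub_zero] at h7
  refine h7.congr fun k => ?_
  simp [toL2]

end Rellich

/-! ### Primitives in `L²(0, T; H)` -/

section Primitive

theorem integrable_of_Lp {F : Type*} [NormedAddCommGroup F] {T : ℝ} (g : Lp F 2 (volT T)) :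
    Integrable g (volT T) :=
  (Lp.memLp g).integrable (by norm_num)

variable {H : Type*} [NormedAddCommGroup H] [InnerProductSpace ℝ H] [CompleteSpace H] {T : ℝ}

theorem exists_integral_norm_le (H : Type*) [NormedAddCommGroup H] (T : ℝ) :
    ∃ C, 0 ≤ C ∧ ∀ g : Lp H 2 (volT T), ∫ t, ‖g t‖ ∂(volT T) ≤ C * ‖g‖ := by
  refine ⟨(volT T univ ^ (1 / (1 : ENNReal).toReal - 1 / (2 : ENNReal).toReal)).toReal,
    ENNReal.toReal_nonneg, fun g => ?_⟩
  have h := eLpNorm_le_eLpNorm_mul_rpow_measure_univ (p := 1) (q := 2) (by norm_num)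
    (Lp.aestronglyMeasurable g)
  have h2 := ENNReal.toReal_mono (ENNReal.mul_ne_top (Lp.eLpNorm_ne_top g)
    (ENNReal.rpow_ne_top_of_nonneg (by norm_num) (measure_ne_top _ _))) h
  rw [ENNReal.toReal_mul, ← Lp.norm_def, mul_comm] at h2
  rwa [integral_norm_eq_lintegral_enorm (Lp.aestronglyMeasurable g),
    ← eLpNorm_one_eq_lintegral_enorm]

/-- `g ↦ ∫ₜᵀ g`, as a bounded linear map on `L²(0, T; H)`. -/
def tailIntegral (H : Type*) [NormedAddCommGroup H] [InnerProductSpace ℝ H] [CompleteSpace H]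
    (T t : ℝ) : Lp H 2 (volT T) →L[ℝ] H :=
  LinearMap.mkContinuousOfExistsBound
    { toFun := fun g => ∫ s in t..T, g s ∂(volT T)
      map_add' := fun f g => by
        rw [← intervalIntegral.integral_add (integrable_of_Lp f).intervalIntegrable
          (integrable_of_Lp g).intervalIntegrable]
        refine intervalIntegral.integral_congr_ae ?_
        filter_upwards [Lp.coeFn_add f g] with s hs _
        rw [hs, Pi.add_apply]
      map_smul' := fun c f => by
        rw [RingHom.id_apply, ← intervalIntegral.integral_smul]
        refine intervalIntegral.integral_congr_ae ?_
        filter_upwards [Lp.coeFn_smul c f] with s hs _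
        rw [hs, Pi.smul_apply] }
    (by
      obtain ⟨C, -, hC⟩ := exists_integral_norm_le H T
      refine ⟨C, fun g => (intervalIntegral.norm_integral_le_integral_norm_uIoc).trans ?_⟩
      exact (setIntegral_le_integral (integrable_of_Lp g).norm
        (Eventually.of_forall fun _ => norm_nonneg _)).trans (hC g))

theorem tailIntegral_apply (t : ℝ) (g : Lp H 2 (volT T)) :
    tailIntegral H T t g = ∫ s in t..T, g s ∂(volT T) := rfl

theorem exists_norm_tailIntegral_le (H : Type*) [NormedAddCommGroup H] [InnerProductSpace ℝ H]
    [CompleteSpace H] (T : ℝ) :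
    ∃ C, 0 ≤ C ∧ ∀ t (g : Lp H 2 (volT T)), ‖tailIntegral H T t g‖ ≤ C * ‖g‖ := by
  obtain ⟨C, h0, hC⟩ := exists_integral_norm_le H T
  refine ⟨C, h0, fun t g => (intervalIntegral.norm_integral_le_integral_norm_uIoc).trans ?_⟩
  exact (setIntegral_le_integral (integrable_of_Lp g).norm
    (Eventually.of_forall fun _ => norm_nonneg _)).trans (hC g)

theorem tailIntegral_self (g : Lp H 2 (volT T)) : tailIntegral H T T g = 0 := by
  simp [tailIntegral_apply]

theorem continuous_tailIntegral (g : Lp H 2 (volT T)) :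
    Continuous fun t => tailIntegral H T t g := by
  have h := intervalIntegral.continuous_primitive (μ := volT T) (f := g)
    (fun a b => (integrable_of_Lp g).intervalIntegrable) T
  simp only [tailIntegral_apply, intervalIntegral.integral_symm T]
  exact h.neg

theorem memLp_tailIntegral (g : Lp H 2 (volT T)) :
    MemLp (fun t => tailIntegral H T t g) 2 (volT T) := by
  obtain ⟨C, -, hC⟩ := exists_norm_tailIntegral_le H T
  have hm : AEStronglyMeasurable (fun t => tailIntegral H T t g) (volT T) :=
    (continuous_tailIntegral g).aestronglyMeasurable
  exact MemLp.of_bound hm _ (Eventually.of_forall fun t => hC t g)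

/-- The operator `(J g)(t) = ∫ₜᵀ g` on `L²(0, T; H)`. -/
def primitiveL (H : Type*) [NormedAddCommGroup H] [InnerProductSpace ℝ H] [CompleteSpace H]
    (T : ℝ) : Lp H 2 (volT T) →L[ℝ] Lp H 2 (volT T) :=
  LinearMap.mkContinuousOfExistsBound
    { toFun := fun g => (memLp_tailIntegral g).toLp _
      map_add' := fun f g => by
        rw [← MemLp.toLp_add]
        congr 1
        ext t
        simp
      map_smul' := fun c f => by
        rw [RingHom.id_apply, ← MemLp.toLp_const_smul]
        congr 1
        ext t
        simp }
    (by
      obtain ⟨C, h0, hC⟩ := exists_norm_tailIntegral_le H T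
      refine ⟨measureUnivNNReal (volT T) ^ (ENNReal.toReal 2)⁻¹ * C, fun g => ?_⟩
      rw [mul_assoc]
      refine Lp.norm_le_of_ae_bound (by positivity) ?_
      filter_upwards [(memLp_tailIntegral g).coeFn_toLp] with t ht
      change ‖(memLp_tailIntegral g).toLp _ t‖ ≤ _
      rw [ht]
      exact hC t g)

theorem coeFn_primitiveL (g : Lp H 2 (volT T)) :
    primitiveL H T g =ᵐ[volT T] fun t => tailIntegral H T t g :=
  (memLp_tailIntegral g).coeFn_toLp

/-- A closed condition on `L²(0, T; H)` can be checked on continuous functions. -/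
theorem Lp_induction_continuous [TopologicalSpace.SeparableSpace H] {P : Lp H 2 (volT T) → Prop}
    (hP : IsClosed {g | P g})
    (h : ∀ (g : Lp H 2 (volT T)) (f : ℝ → H), Continuous f → g =ᵐ[volT T] f → P g)
    (g : Lp H 2 (volT T)) : P g := by
  have hd := BoundedContinuousFunction.toLp_denseRange H (volT T) (p := 2) ℝ (by norm_num)
  refine hd.induction_on g hP fun f => h _ f f.continuous ?_
  exact BoundedContinuousFunction.coeFn_toLp (p := 2) (volT T) (𝕜 := ℝ) f

theorem tailIntegral_eq_of_ae {g : Lp H 2 (volT T)} {f : ℝ → H} (hg : g =ᵐ[volT T] f) {t : ℝ}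
    (ht : t ∈ Icc 0 T) : tailIntegral H T t g = ∫ s in t..T, f s := by
  rw [tailIntegral_apply, intervalIntegral.integral_congr_ae (g := f)
    (by filter_upwards [hg] with s hs _ using hs),
    intervalIntegral.integral_of_le ht.2, intervalIntegral.integral_of_le ht.2,
    volT, Measure.restrict_congr_set Ioo_ae_eq_Ioc, Measure.restrict_restrict measurableSet_Ioc,
    inter_eq_self_of_subset_left (Ioc_subset_Ioc_left ht.1)]

theorem hasDerivAt_integral_left {f : ℝ → H} (hf : Continuous f) (t : ℝ) :
    HasDerivAt (fun t => ∫ s in t..T, f s) (-f t) t :=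
  intervalIntegral.integral_hasDerivAt_left (hf.intervalIntegrable _ _)
    (hf.stronglyMeasurableAtFilter _ _) hf.continuousAt

/-- If `K` is symmetric and nonnegative, then `∫₀ᵀ ⟨K (J g), g⟩ = ½ ⟨K (J g)(0), (J g)(0)⟩ ≥ 0`. -/
theorem inner_compLpL_primitiveL_nonneg [TopologicalSpace.SeparableSpace H] (hT : 0 < T)
    (K : H →L[ℝ] H) (hsymm : ∀ v w, (inner ℝ (K v) w : ℝ) = inner ℝ (K w) v)
    (hpos : ∀ v, 0 ≤ (inner ℝ (K v) v : ℝ)) (g : Lp H 2 (volT T)) :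
    0 ≤ (inner ℝ (K.compLpL 2 (volT T) (primitiveL H T g)) g : ℝ) := by
  refine Lp_induction_continuous (P := fun g =>
    0 ≤ (inner ℝ (K.compLpL 2 (volT T) (primitiveL H T g)) g : ℝ)) ?_ ?_ g
  · exact isClosed_le continuous_const
      (((K.compLpL 2 (volT T)).continuous.comp (primitiveL H T).continuous).inner continuous_id)
  intro g f hf hg
  have hD := fun t => hasDerivAt_integral_left (T := T) hf t
  have hF : Continuous fun t => ∫ s in t..T, f s :=
    continuous_iff_continuousAt.2 fun t => (hD t).continuousAt
  have e : (inner ℝ (K.compLpL 2 (volT T) (primitiveL H T g)) g : ℝ) =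
      ∫ t in (0 : ℝ)..T, inner ℝ (K (∫ s in t..T, f s)) (f t) := by
    rw [L2.inner_def, intervalIntegral.integral_of_le hT.le, integral_Ioc_eq_integral_Ioo]
    refine integral_congr_ae ?_
    filter_upwards [hg, coeFn_primitiveL g, ae_restrict_mem measurableSet_Ioo,
      ContinuousLinearMap.coeFn_compLpL K (primitiveL H T g)] with t h1 h2 h3 h4
    rw [h4, h2, h1, tailIntegral_eq_of_ae hg (Ioo_subset_Icc_self h3)]
  have hQ : ∀ t ∈ uIcc 0 T, HasDerivAt
      (fun t => (inner ℝ (K (∫ s in t..T, f s)) (∫ s in t..T, f s) : ℝ))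
      (-2 * inner ℝ (K (∫ s in t..T, f s)) (f t)) t := by
    intro t _
    refine (((K.hasFDerivAt.comp_hasDerivAt t (hD t)).inner ℝ (hD t))).congr_deriv ?_
    rw [map_neg, inner_neg_left, inner_neg_right, hsymm (f t), Function.comp_apply]
    ring
  have hint := intervalIntegral.integral_eq_sub_of_hasDerivAt hQ
    (Continuous.intervalIntegrable (by fun_prop) _ _)
  rw [intervalIntegral.integral_const_mul, intervalIntegral.integral_same, map_zero,
    inner_zero_left] at hint
  rw [e]
  have := hpos (∫ s in (0 : ℝ)..T, f s)
  linarith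

/-- Integration against a bounded continuous weight and a functional is an inner product. -/
theorem exists_integral_mul_eq_inner (l : StrongDual ℝ H) {η : ℝ → ℝ} (hη : Continuous η)
    (hc : HasCompactSupport η) :
    ∃ e : Lp H 2 (volT T), ∀ u : Lp H 2 (volT T),
      ∫ t in Ioo 0 T, η t * l (u t) = inner ℝ e u := by
  obtain ⟨C, hC⟩ := hc.exists_bound_of_continuous hη
  have hm : MemLp (fun t => η t • (InnerProductSpace.toDual ℝ H).symm l) 2 (volT T) :=
    MemLp.of_bound (by fun_prop) (C * ‖(InnerProductSpace.toDual ℝ H).symm l‖)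
      (Eventually.of_forall fun t => by rw [norm_smul]; gcongr; exact hC t)
  refine ⟨hm.toLp _, fun u => ?_⟩
  rw [L2.inner_def]
  refine integral_congr_ae ?_
  filter_upwards [hm.coeFn_toLp] with t ht
  rw [ht, real_inner_smul_left, InnerProductSpace.toDual_symm_apply]

/-- The weak time derivative of `J g` is `-g`. -/
theorem integral_deriv_mul_primitiveL [TopologicalSpace.SeparableSpace H] (hT : 0 < T)
    (l : StrongDual ℝ H) {η : ℝ → ℝ} (hη : ContDiff ℝ ∞ η) (hc : HasCompactSupport η)
    (hs : tsupport η ⊆ Ioo 0 T) (g : Lp H 2 (volT T)) :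
    ∫ t in Ioo 0 T, deriv η t * l (primitiveL H T g t) = ∫ t in Ioo 0 T, η t * l (g t) := by
  have hη' : Continuous (deriv η) := hη.continuous_deriv (by simp)
  obtain ⟨e₁, he₁⟩ := exists_integral_mul_eq_inner (T := T) l hη' hc.deriv
  obtain ⟨e₂, he₂⟩ := exists_integral_mul_eq_inner (T := T) l hη.continuous hc
  refine Lp_induction_continuous (P := fun g =>
    ∫ t in Ioo 0 T, deriv η t * l (primitiveL H T g t) = ∫ t in Ioo 0 T, η t * l (g t)) ?_ ?_ g
  · simp_rw [he₁, he₂]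
    exact isClosed_eq (continuous_const.inner (primitiveL H T).continuous)
      (continuous_const.inner continuous_id)
  intro g f hf hg
  have hD := fun t => hasDerivAt_integral_left (T := T) hf t
  have h0 : ∀ t ∉ Ioo 0 T, η t = 0 := fun t ht => by
    by_contra h
    exact ht (hs (subset_tsupport η h))
  have hparts := intervalIntegral.integral_mul_deriv_eq_deriv_mul (a := 0) (b := T)
    (u := η) (v := fun t => l (∫ s in t..T, f s)) (u' := deriv η) (v' := fun t => l (-f t))
    (fun t _ => (hη.differentiable (by simp) t).hasDerivAt)
    (fun t _ => l.hasFDerivAt.comp_hasDerivAt t (hD t))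
    (hη'.intervalIntegrable _ _) (Continuous.intervalIntegrable (by fun_prop) _ _)
  rw [h0 0 (by simp), h0 T (by simp)] at hparts
  have e1 : ∫ t in Ioo 0 T, deriv η t * l (primitiveL H T g t) =
      ∫ t in (0 : ℝ)..T, deriv η t * l (∫ s in t..T, f s) := by
    rw [intervalIntegral.integral_of_le hT.le, integral_Ioc_eq_integral_Ioo]
    refine integral_congr_ae ?_
    filter_upwards [coeFn_primitiveL g, ae_restrict_mem measurableSet_Ioo] with t h1 h2
    rw [h1, tailIntegral_eq_of_ae hg (Ioo_subset_Icc_self h2)]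
  have e2 : ∫ t in Ioo 0 T, η t * l (g t) = -∫ t in (0 : ℝ)..T, η t * l (-f t) := by
    rw [intervalIntegral.integral_of_le hT.le, integral_Ioc_eq_integral_Ioo, ← integral_neg]
    refine integral_congr_ae ?_
    filter_upwards [hg] with t h1
    rw [h1, map_neg, mul_neg, neg_neg]
  rw [e1, e2, hparts]
  simp

end Primitive

/-! ### Functions with vanishing weak derivative -/

section DuBoisReymond

variable {T : ℝ}

/-- A smooth function with compact support in `(0, T)` and integral zero is the derivative of such
a function. -/
theorem exists_test_primitive {ψ : ℝ → ℝ} (hT : 0 < T) (hψ : ContDiff ℝ ∞ ψ)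
    (hc : HasCompactSupport ψ) (hs : tsupport ψ ⊆ Ioo 0 T) (h0 : ∫ t, ψ t = 0) :
    ∃ η : ℝ → ℝ, ContDiff ℝ ∞ η ∧ HasCompactSupport η ∧ tsupport η ⊆ Ioo 0 T ∧ deriv η = ψ := by
  obtain ⟨a, b, ha, hb, hab⟩ : ∃ a b, 0 < a ∧ b < T ∧ tsupport ψ ⊆ Icc a b := by
    have hK : IsCompact (insert (T / 2) (tsupport ψ)) := hc.isCompact.insert _
    have hsub : insert (T / 2) (tsupport ψ) ⊆ Ioo 0 T :=
      insert_subset ⟨by linarith, by linarith⟩ hs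
    obtain ⟨a, ha⟩ := hK.exists_isLeast ⟨_, mem_insert _ _⟩
    obtain ⟨b, hb⟩ := hK.exists_isGreatest ⟨_, mem_insert _ _⟩
    exact ⟨a, b, (hsub ha.1).1, (hsub hb.1).2, fun t ht =>
      ⟨ha.2 (mem_insert_of_mem _ ht), hb.2 (mem_insert_of_mem _ ht)⟩⟩
  have hz : ∀ t, t ∉ Icc a b → ψ t = 0 := fun t ht => by
    by_contra h
    exact ht (hab (subset_tsupport ψ h))
  have hD : ∀ t, HasDerivAt (fun t => ∫ s in (0 : ℝ)..t, ψ s) (ψ t) t := fun t =>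
    intervalIntegral.integral_hasDerivAt_right (hψ.continuous.intervalIntegrable _ _)
      (hψ.continuous.stronglyMeasurableAtFilter _ _) hψ.continuous.continuousAt
  have hder : deriv (fun t => ∫ s in (0 : ℝ)..t, ψ s) = ψ := funext fun t => (hD t).deriv
  have hsupp : Function.support (fun t => ∫ s in (0 : ℝ)..t, ψ s) ⊆ Icc a b := by
    intro t ht
    by_contra hn
    refine ht ?_
    rcases lt_or_ge t a with h | h
    · refine intervalIntegral.integral_zero_ae (Eventually.of_forall fun s hs => hz s fun hm => ?_)
      rcases le_total 0 t with h' | h'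
      · rw [uIoc_of_le h'] at hs
        linarith [hs.2, hm.1]
      · rw [uIoc_of_ge h'] at hs
        linarith [hs.2, hm.1]
    · have hb' : b < t := by
        by_contra hle
        exact hn ⟨h, not_lt.1 hle⟩
      change ∫ s in (0 : ℝ)..t, ψ s = 0
      rw [intervalIntegral.integral_eq_integral_of_support_subset, h0]
      intro s hs
      have : s ∈ Icc a b := by
        by_contra h
        exact hs (hz s h)
      exact ⟨by linarith [this.1], by linarith [this.2]⟩
  have ht : tsupport (fun t => ∫ s in (0 : ℝ)..t, ψ s) ⊆ Icc a b :=
    closure_minimal hsupp isClosed_Icc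
  refine ⟨fun t => ∫ s in (0 : ℝ)..t, ψ s, ?_, ?_, ht.trans fun t h => ?_, hder⟩
  · exact contDiff_infty_iff_deriv.2 ⟨fun t => (hD t).differentiableAt, by rwa [hder]⟩
  · exact isCompact_Icc.of_isClosed_subset (isClosed_tsupport _) ht
  · exact ⟨by linarith [h.1], by linarith [h.2]⟩

/-- The du Bois-Reymond lemma for continuous functions on `[0, T]`. -/
theorem eqOn_const_of_integral_deriv_mul_eq_zero (hT : 0 < T) {h : ℝ → ℝ}
    (hh : ContinuousOn h (Icc 0 T))
    (hw : ∀ η : ℝ → ℝ, ContDiff ℝ ∞ η → HasCompactSupport η → tsupport η ⊆ Ioo 0 T →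
      ∫ t in Ioo 0 T, deriv η t * h t = 0) {t : ℝ} (ht : t ∈ Icc 0 T) : h t = h T := by
  let β : ContDiffBump (T / 2) := ⟨T / 8, T / 4, by positivity, by linarith⟩
  let χ : ℝ → ℝ := β.normed volume
  have hχ : ContDiff ℝ ∞ χ := β.contDiff_normed
  have hχc : HasCompactSupport χ := β.hasCompactSupport_normed
  have hχs : tsupport χ ⊆ Ioo 0 T := by
    rw [β.tsupport_normed_eq, Real.closedBall_eq_Icc]
    intro s hs
    change s ∈ Icc (T / 2 - T / 4) (T / 2 + T / 4) at hs
    exact ⟨by linarith [hs.1], by linarith [hs.2]⟩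
  have hχ1 : ∫ t, χ t = 1 := β.integral_normed
  have hhint : IntegrableOn h (Ioo 0 T) :=
    (hh.integrableOn_compact isCompact_Icc).mono_set Ioo_subset_Icc_self
  have hprod : ∀ φ : ℝ → ℝ, Continuous φ → HasCompactSupport φ →
      Integrable (fun t => φ t * h t) (volT T) := by
    intro φ hφ hφc
    obtain ⟨C, hC⟩ := hφc.exists_bound_of_continuous hφ
    exact hhint.bdd_mul hφ.aestronglyMeasurable (Eventually.of_forall hC)
  set c := ∫ t in Ioo 0 T, χ t * h t with hcdef
  have hae : ∀ᵐ t, t ∈ Ioo 0 T → h t - c = 0 := by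
    refine isOpen_Ioo.ae_eq_zero_of_integral_contDiff_smul_eq_zero ?_ fun φ hφ hφc hφs => ?_
    · have hi : IntegrableOn (fun t => h t - c) (Ioo 0 T) :=
        Integrable.sub hhint (integrable_const c)
      exact hi.locallyIntegrableOn
    have hφi : Integrable φ := hφ.continuous.integrable_of_hasCompactSupport hφc
    have hχi : Integrable χ := hχ.continuous.integrable_of_hasCompactSupport hχc
    have hzero : ∀ t ∉ Ioo 0 T, φ t = 0 := fun t ht => by
      by_contra h
      exact ht (hφs (subset_tsupport φ h))
    obtain ⟨η, h1, h2, h3, h4⟩ := exists_test_primitive (T := T)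
      (ψ := fun t => φ t - (∫ t, φ t) * χ t) hT (hφ.sub (contDiff_const.mul hχ))
      (hφc.sub hχc.mul_left)
      ((tsupport_sub φ _).trans (union_subset hφs ((tsupport_mul_subset_right).trans hχs)))
      (by rw [integral_sub hφi (hχi.const_mul _), integral_const_mul, hχ1]; ring)
    have h5 := hw η h1 h2 h3
    rw [h4] at h5
    have h6 : ∫ t in Ioo 0 T, (φ t - (∫ t, φ t) * χ t) * h t =
        (∫ t in Ioo 0 T, φ t * h t) - (∫ t, φ t) * c := by
      rw [hcdef, ← integral_const_mul, ← integral_sub (hprod φ hφ.continuous hφc)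
        ((hprod χ hχ.continuous hχc).const_mul _)]
      congr 1
      ext t
      ring
    have h7 : ∫ t, φ t = ∫ t in Ioo 0 T, φ t :=
      (setIntegral_eq_integral_of_forall_compl_eq_zero hzero).symm
    rw [← setIntegral_eq_integral_of_forall_compl_eq_zero (s := Ioo 0 T)
      fun t ht => by rw [hzero t ht, zero_smul]]
    simp only [smul_eq_mul, mul_sub]
    rw [integral_sub (hprod φ hφ.continuous hφc) (hφi.integrableOn.mul_const c),
      integral_mul_const, ← h7]
    linarith
  have heq : EqOn h (fun _ => c) (Icc 0 T) := by
    refine Measure.eqOn_Icc_of_ae_eq volume hT.ne ?_ hh continuousOn_const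
    rw [← Measure.restrict_congr_set Ioo_ae_eq_Icc]
    filter_upwards [ae_restrict_of_ae hae, ae_restrict_mem measurableSet_Ioo] with t h1 h2
    linarith [h1 h2]
  rw [heq ht, heq (right_mem_Icc.2 hT.le)]

end DuBoisReymond

/-! ### Operators acting pointwise in time -/

section Pointwise

variable {H F : Type*} [NormedAddCommGroup H] [InnerProductSpace ℝ H]
  [NormedAddCommGroup F] [InnerProductSpace ℝ F] {T : ℝ}

theorem norm_compLpL_le (K : H →L[ℝ] H) {M : ℝ} (hM : ∀ v, ‖K v‖ ≤ M * ‖v‖)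
    (g : Lp H 2 (volT T)) : ‖K.compLpL 2 (volT T) g‖ ≤ M * ‖g‖ := by
  refine Lp.norm_le_mul_norm_of_ae_le_mul ?_
  filter_upwards [ContinuousLinearMap.coeFn_compLpL K g] with t ht
  rw [ht]
  exact hM _

theorem le_inner_compLpL (K : H →L[ℝ] H) {c : ℝ} (hc : ∀ v, c * ‖v‖ ^ 2 ≤ inner ℝ (K v) v)
    (g : Lp H 2 (volT T)) : c * ‖g‖ ^ 2 ≤ inner ℝ (K.compLpL 2 (volT T) g) g := by
  rw [← real_inner_self_eq_norm_sq, ← real_inner_smul_left, L2.inner_def, L2.inner_def]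
  refine integral_mono_ae (L2.integrable_inner _ _) (L2.integrable_inner _ _) ?_
  filter_upwards [ContinuousLinearMap.coeFn_compLpL K g, Lp.coeFn_smul c g] with t h1 h2
  rw [h1, h2, Pi.smul_apply, real_inner_smul_left, real_inner_self_eq_norm_sq]
  exact hc _

theorem inner_compLpL_sub_compLpL (A B : H →L[ℝ] H) (u u' φ : Lp H 2 (volT T)) :
    (inner ℝ (A.compLpL 2 (volT T) u - B.compLpL 2 (volT T) u') φ : ℝ) =
      ∫ t in Ioo 0 T, inner ℝ (A (u t) - B (u' t)) (φ t) := by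
  rw [L2.inner_def]
  refine integral_congr_ae ?_
  filter_upwards [Lp.coeFn_sub (A.compLpL 2 (volT T) u) (B.compLpL 2 (volT T) u'),
    ContinuousLinearMap.coeFn_compLpL A u, ContinuousLinearMap.coeFn_compLpL B u'] with t h1 h2 h3
  rw [h1, Pi.sub_apply, h2, h3]

theorem norm_compLp_sq (L : H →L[ℝ] F) {u : Lp H 2 (volT T)} {r : ℝ → H} (hu : u =ᵐ[volT T] r) :
    ‖L.compLp u‖ ^ 2 = ∫ t in Ioo 0 T, ‖L (r t)‖ ^ 2 := by
  rw [← real_inner_self_eq_norm_sq, L2.inner_def]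
  refine integral_congr_ae ?_
  filter_upwards [ContinuousLinearMap.coeFn_compLp L u, hu] with t h1 h2
  rw [h1, h2, real_inner_self_eq_norm_sq]

theorem integrable_mul_apply (u : Lp H 2 (volT T)) (l : StrongDual ℝ H) {η : ℝ → ℝ}
    (hη : Continuous η) (hc : HasCompactSupport η) :
    Integrable (fun t => η t * l (u t)) (volT T) := by
  obtain ⟨C, hC⟩ := hc.exists_bound_of_continuous hη
  exact (l.integrable_comp (integrable_of_Lp u)).bdd_mul hη.aestronglyMeasurable
    (Eventually.of_forall hC)

theorem integral_mul_neg (l : StrongDual ℝ H) (η : ℝ → ℝ) (g : Lp H 2 (volT T)) :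
    ∫ t in Ioo 0 T, η t * l ((-g : Lp H 2 (volT T)) t) = -∫ t in Ioo 0 T, η t * l (g t) := by
  rw [← integral_neg]
  refine integral_congr_ae ?_
  filter_upwards [Lp.coeFn_neg g] with t ht
  rw [ht, Pi.neg_apply, map_neg, mul_neg]

end Pointwise

/-! ### Functions in `L²(0, T; H)` with a weak derivative -/

section WeakDerivative

variable {H : Type*} [NormedAddCommGroup H] [InnerProductSpace ℝ H] [CompleteSpace H] {T : ℝ}

/-- The function `t ↦ a + ∫ₜᵀ g`, with value `a` at `T` and derivative `-g`. -/
def affinePrimitive (T : ℝ) (a : H) (g : Lp H 2 (volT T)) : Lp H 2 (volT T) :=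
  Lp.constL 2 (volT T) ℝ a + primitiveL H T g

theorem coeFn_affinePrimitive (a : H) (g : Lp H 2 (volT T)) :
    affinePrimitive T a g =ᵐ[volT T] fun t => a + tailIntegral H T t g := by
  filter_upwards [Lp.coeFn_add (Lp.constL 2 (volT T) ℝ a) (primitiveL H T g),
    Lp.coeFn_const (p := 2) (μ := volT T) a, coeFn_primitiveL g] with t e1 e2 e3
  have e4 : (Lp.constL 2 (volT T) ℝ a : Lp H 2 (volT T)) t = a := e2
  rw [affinePrimitive, e1, Pi.add_apply, e4, e3]

theorem integral_deriv_eq_zero_of_tsupport_subset (hT : 0 < T) {η : ℝ → ℝ} (hη : ContDiff ℝ ∞ η)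
    (hs : tsupport η ⊆ Ioo 0 T) : ∫ t in Ioo 0 T, deriv η t = 0 := by
  have h0 : ∀ t ∉ Ioo 0 T, η t = 0 := fun t ht => by
    by_contra h
    exact ht (hs (subset_tsupport η h))
  rw [← integral_Ioc_eq_integral_Ioo, ← intervalIntegral.integral_of_le hT.le,
    intervalIntegral.integral_deriv_eq_sub (fun t _ => hη.differentiable (by simp) t)
      ((hη.continuous_deriv (by simp)).intervalIntegrable _ _), h0 0 (by simp), h0 T (by simp),
    sub_zero]

theorem integral_deriv_mul_affinePrimitive [TopologicalSpace.SeparableSpace H] (hT : 0 < T)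
    (l : StrongDual ℝ H) {η : ℝ → ℝ} (h1 : ContDiff ℝ ∞ η) (h2 : HasCompactSupport η)
    (h3 : tsupport η ⊆ Ioo 0 T) (a : H) (g : Lp H 2 (volT T)) :
    ∫ t in Ioo 0 T, deriv η t * l (affinePrimitive T a g t) =
      -∫ t in Ioo 0 T, η t * l ((-g : Lp H 2 (volT T)) t) := by
  have hη' : Continuous (deriv η) := h1.continuous_deriv (by simp)
  have e1 : ∫ t in Ioo 0 T, deriv η t * l (affinePrimitive T a g t) =
      (∫ t in Ioo 0 T, deriv η t * l a) +
        ∫ t in Ioo 0 T, deriv η t * l (primitiveL H T g t) := by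
    rw [← integral_add _ (integrable_mul_apply _ l hη' h2.deriv)]
    · refine integral_congr_ae ?_
      filter_upwards [coeFn_affinePrimitive a g, coeFn_primitiveL g] with t e1 e2
      rw [e1, e2, map_add, mul_add]
    · exact ((hη'.integrable_of_hasCompactSupport h2.deriv).integrableOn).mul_const _
  rw [e1, integral_mul_neg, integral_mul_const, integral_deriv_eq_zero_of_tsupport_subset hT h1 h3,
    integral_deriv_mul_primitiveL hT l h1 h2 h3, zero_mul, zero_add, neg_neg]

/-- A function with weak derivative `w` and a continuous representative with final value `a` is
`t ↦ a - ∫ₜᵀ w`. -/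
theorem eq_affinePrimitive_of_weakDeriv [TopologicalSpace.SeparableSpace H] (hT : 0 < T)
    {u w : Lp H 2 (volT T)} {r : ℝ → H} (hr : ContinuousOn r (Icc 0 T)) (hur : u =ᵐ[volT T] r)
    (hw : ∀ (η : ℝ → ℝ), ContDiff ℝ ∞ η → HasCompactSupport η → tsupport η ⊆ Ioo 0 T →
      ∀ l : StrongDual ℝ H,
        ∫ t in Ioo 0 T, deriv η t * l (u t) = -∫ t in Ioo 0 T, η t * l (w t)) :
    u = affinePrimitive T (r T) (-w) := by
  refine Lp.ext (hur.trans (EventuallyEq.trans ?_ (coeFn_affinePrimitive (r T) (-w)).symm))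
  filter_upwards [ae_restrict_mem measurableSet_Ioo] with t ht
  rw [← sub_eq_iff_eq_add]
  refine (SeparatingDual.eq_iff_forall_dual_eq (R := ℝ)).2 fun l => ?_
  have hcont : ContinuousOn (fun t => l (r t - tailIntegral H T t (-w))) (Icc 0 T) :=
    l.continuous.comp_continuousOn (hr.sub (continuous_tailIntegral _).continuousOn)
  have key := eqOn_const_of_integral_deriv_mul_eq_zero hT hcont ?_ (Ioo_subset_Icc_self ht)
  · rwa [tailIntegral_self, sub_zero] at key
  intro η h1 h2 h3
  have hη' : Continuous (deriv η) := h1.continuous_deriv (by simp)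
  have e1 : ∫ t in Ioo 0 T, deriv η t * l (r t - tailIntegral H T t (-w)) =
      (∫ t in Ioo 0 T, deriv η t * l (u t)) -
        ∫ t in Ioo 0 T, deriv η t * l (primitiveL H T (-w) t) := by
    rw [← integral_sub (integrable_mul_apply _ l hη' h2.deriv)
      (integrable_mul_apply _ l hη' h2.deriv)]
    refine integral_congr_ae ?_
    filter_upwards [hur, coeFn_primitiveL (-w)] with t e1 e2
    rw [e1, e2, map_sub, mul_sub]
  rw [e1, hw η h1 h2 h3 l, integral_deriv_mul_primitiveL hT l h1 h2 h3, integral_mul_neg, sub_self]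

/-- The operator `g ↦ A (J g) + B g` on `L²(0, T; H)`. In terms of the rate `g = -m_t`, the
evolution problem `A m - B m_t = f` with final value zero is the equation `A (J g) + B g = f`. -/
def evolutionOp (T : ℝ) (A B : H →L[ℝ] H) : Lp H 2 (volT T) →L[ℝ] Lp H 2 (volT T) :=
  (A.compLpL 2 (volT T)).comp (primitiveL H T) + B.compLpL 2 (volT T)

theorem evolutionOp_apply (A B : H →L[ℝ] H) (g : Lp H 2 (volT T)) : evolutionOp T A B g =
    A.compLpL 2 (volT T) (primitiveL H T g) + B.compLpL 2 (volT T) g := rfl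

theorem compLpL_affinePrimitive_sub (A B : H →L[ℝ] H) (a : H) (g : Lp H 2 (volT T)) :
    A.compLpL 2 (volT T) (affinePrimitive T a g) - B.compLpL 2 (volT T) (-g) =
      A.compLpL 2 (volT T) (Lp.constL 2 (volT T) ℝ a) + evolutionOp T A B g := by
  rw [affinePrimitive, evolutionOp_apply, map_neg, sub_neg_eq_add, map_add, add_assoc]

theorem eq_toDual_iff (f x : H) :
    (∀ w, (inner ℝ x w : ℝ) = InnerProductSpace.toDual ℝ H f w) ↔ x = f := by
  simp only [InnerProductSpace.toDual_apply_apply]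
  exact ⟨fun h => ext_inner_right ℝ h, fun h w => by rw [h]⟩

/-- The equation `A m - B m_t = f` for `m = a + ∫ₜᵀ g`, tested against `L²(0, T; H)`. -/
theorem evolutionOp_eq_iff (A B : H →L[ℝ] H) (a : H) (g f : Lp H 2 (volT T)) :
    evolutionOp T A B g = f - A.compLpL 2 (volT T) (Lp.constL 2 (volT T) ℝ a) ↔
      ∀ φ : Lp H 2 (volT T), ∫ t in Ioo 0 T,
        inner ℝ (A (affinePrimitive T a g t) - B ((-g : Lp H 2 (volT T)) t)) (φ t) =
          InnerProductSpace.toDual ℝ (Lp H 2 (volT T)) f φ := by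
  rw [eq_sub_iff_add_eq', ← eq_toDual_iff]
  refine forall_congr' fun φ => ?_
  rw [← compLpL_affinePrimitive_sub, inner_compLpL_sub_compLpL]

theorem norm_evolutionOp_le {A B : H →L[ℝ] H} {M N : ℝ} (hM : 0 ≤ M) (hA : ∀ v, ‖A v‖ ≤ M * ‖v‖)
    (hB : ∀ v, ‖B v‖ ≤ N * ‖v‖) (g : Lp H 2 (volT T)) :
    ‖evolutionOp T A B g‖ ≤ (M * ‖primitiveL H T‖ + N) * ‖g‖ := by
  rw [evolutionOp_apply]
  refine (norm_add_le _ _).trans ?_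
  rw [add_mul]
  refine add_le_add ?_ (norm_compLpL_le _ hB g)
  refine (norm_compLpL_le _ hA _).trans ?_
  rw [mul_assoc]
  gcongr
  exact (primitiveL H T).le_opNorm g

theorem le_inner_evolutionOp [TopologicalSpace.SeparableSpace H] (hT : 0 < T) {A B : H →L[ℝ] H}
    {c : ℝ} (hsymm : ∀ v w, (inner ℝ (A v) w : ℝ) = inner ℝ (A w) v)
    (hpos : ∀ v, 0 ≤ (inner ℝ (A v) v : ℝ)) (hB : ∀ v, c * ‖v‖ ^ 2 ≤ inner ℝ (B v) v)
    (g : Lp H 2 (volT T)) : c * ‖g‖ ^ 2 ≤ inner ℝ (evolutionOp T A B g) g := by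
  rw [evolutionOp_apply, inner_add_left]
  exact (le_inner_compLpL B hB g).trans
    (le_add_of_nonneg_left (inner_compLpL_primitiveL_nonneg hT A hsymm hpos g))

/-- For final data `a k` that are weakly null along `σ`, there is one right-hand side `f` such that
the rates `g k`, the solutions of `A (J g) + B g = f - A a`, are weakly null along a further
subsequence. -/
theorem exists_rhs_evolution [TopologicalSpace.SeparableSpace H] (hT : 0 < T) {A B : ℕ → H →L[ℝ] H}
    {c M N : ℝ} (hc : 0 < c) (hM : 0 < M) (hN : 0 < N)
    (hsymm : ∀ k v w, (inner ℝ (A k v) w : ℝ) = inner ℝ (A k w) v)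
    (hpos : ∀ k v, 0 ≤ (inner ℝ (A k v) v : ℝ)) (hB : ∀ k v, c * ‖v‖ ^ 2 ≤ inner ℝ (B k v) v)
    (hAM : ∀ k v, ‖A k v‖ ≤ M * ‖v‖) (hBN : ∀ k v, ‖B k v‖ ≤ N * ‖v‖)
    (a : ℕ → H) {σ : ℕ → ℕ} (ha : WeaklyNull (a ∘ σ)) :
    ∃ (f : Lp H 2 (volT T)) (g : ℕ → Lp H 2 (volT T)),
      (∀ k u, evolutionOp T (A k) (B k) u =
        f - (A k).compLpL 2 (volT T) (Lp.constL 2 (volT T) ℝ (a k)) ↔ u = g k) ∧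
      ∃ τ : ℕ → ℕ, StrictMono τ ∧ WeaklyNull (g ∘ σ ∘ τ) := by
  have hcoer := fun k => le_inner_evolutionOp hT (hsymm k) (hpos k) (hB k)
  choose e he using fun k => exists_equiv_of_coercive (evolutionOp T (A k) (B k)) hc (hcoer k)
  have he' : ∀ k u, c * ‖u‖ ^ 2 ≤ inner ℝ (e k u) u := fun k u => by
    rw [he]; exact hcoer k u
  obtain ⟨D, hD⟩ := ha.exists_norm_le
  obtain ⟨f, τ, hτ, hg⟩ := exists_rhs_weaklyNull (fun k => e (σ k))
    (fun k => (e (σ k)).symm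
      ((A (σ k)).compLpL 2 (volT T) (Lp.constL 2 (volT T) ℝ (a (σ k))))) hc
    (M := M * ‖primitiveL H T‖ + N) (by positivity) (fun k => he' (σ k))
    (fun k u => by rw [he]; exact norm_evolutionOp_le hM.le (hAM (σ k)) (hBN (σ k)) u)
    (D := c⁻¹ * (M * (‖(Lp.constL 2 (volT T) ℝ : H →L[ℝ] Lp H 2 (volT T))‖ * D)))
    (fun k => by
      refine (norm_symm_apply_le hc (he' (σ k)) _).trans ?_
      gcongr
      refine (norm_compLpL_le _ (hAM (σ k)) _).trans ?_
      gcongr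
      refine (ContinuousLinearMap.le_opNorm _ _).trans ?_
      gcongr
      exact hD k)
  refine ⟨f, fun k => (e k).symm f -
    (e k).symm ((A k).compLpL 2 (volT T) (Lp.constL 2 (volT T) ℝ (a k))), fun k u => ?_, τ, hτ, hg⟩
  rw [← he, equiv_apply_eq_sub_iff]

/-- If the final data and the rates are weakly null and `L` maps weakly null sequences to null
sequences, then `L (a k + ∫ₜᵀ g k)` tends to zero in `L²(0, T; F)`: evaluation at each time is
weakly continuous, so there is convergence at each time, and dominated convergence does the rest. -/
theorem tendsto_compLp_affinePrimitive {F : Type*} [NormedAddCommGroup F] [InnerProductSpace ℝ F]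
    (L : H →L[ℝ] F) (hL : ∀ v : ℕ → H, WeaklyNull v → Tendsto (fun k => L (v k)) atTop (𝓝 0))
    {a : ℕ → H} {g : ℕ → Lp H 2 (volT T)} (ha : WeaklyNull a) (hg : WeaklyNull g) :
    Tendsto (fun k => L.compLp (affinePrimitive T (a k) (g k))) atTop (𝓝 0) := by
  obtain ⟨A, hA⟩ := ha.exists_norm_le
  obtain ⟨G, hG⟩ := hg.exists_norm_le
  obtain ⟨C, hC0, hC⟩ := exists_norm_tailIntegral_le H T
  have hlim : Tendsto (fun k => ‖L.compLp (affinePrimitive T (a k) (g k))‖ ^ 2) atTop (𝓝 0) := by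
    simp_rw [norm_compLp_sq L (coeFn_affinePrimitive (a _) (g _))]
    have hdom := tendsto_integral_of_dominated_convergence (μ := volT T)
      (F := fun k t => ‖L (a k + tailIntegral H T t (g k))‖ ^ 2) (f := fun _ => 0)
      (fun _ => (‖L‖ * (A + C * G)) ^ 2) (fun k => ?_) (integrable_const _)
      (fun k => Eventually.of_forall fun t => ?_) (Eventually.of_forall fun t => ?_)
    · simpa using hdom
    · exact ((L.continuous.comp
        (continuous_const.add (continuous_tailIntegral (g k)))).norm.pow 2).aestronglyMeasurable
    · rw [norm_pow, norm_norm]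
      gcongr
      refine (L.le_opNorm _).trans ?_
      gcongr
      refine (norm_add_le _ _).trans (add_le_add (hA k) ((hC t _).trans ?_))
      gcongr
      exact hG k
    · have := (hL _ (ha.add (hg.map (tailIntegral H T t)))).norm.pow 2
      simpa using this
  have h0 := hlim.sqrt
  simp only [Real.sqrt_sq (norm_nonneg _), Real.sqrt_zero] at h0
  exact tendsto_zero_iff_norm_tendsto_zero.2 h0

end WeakDerivative

/-! ### Elements of `𝒲` as primitives of their time derivatives -/

section Trajectories

variable {U : Set E3} {T : ℝ}

theorem isTimeDeriv_affinePrimitive (hT : 0 < T) (a : V U) (g : VT U T) :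
    IsTimeDeriv (affinePrimitive T a g) (-g) :=
  fun _ h1 h2 h3 l => integral_deriv_mul_affinePrimitive hT l h1 h2 h3 a g

/-- The element `a + ∫ₜᵀ g` of `𝒲`, with final value `a` and time derivative `-g`. -/
def trajectory (U : Set E3) (hT : 0 < T) : V U × VT U T →L[ℝ] W U T :=
  ((WithLp.prodContinuousLinearEquiv 2 ℝ (VT U T) (VT U T)).symm.toContinuousLinearMap.comp
    (((Lp.constL 2 (volT T) ℝ).comp (ContinuousLinearMap.fst ℝ (V U) (VT U T)) +
      (primitiveL (V U) T).comp (ContinuousLinearMap.snd ℝ (V U) (VT U T))).prod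
        (-ContinuousLinearMap.snd ℝ (V U) (VT U T)))).codRestrict (W U T)
    fun x => isTimeDeriv_affinePrimitive hT x.1 x.2

theorem hasFinalValue_trajectory (hT : 0 < T) (a : V U) (g : VT U T) :
    HasFinalValue (trajectory U hT (a, g)) a :=
  ⟨fun t => a + tailIntegral (V U) T t g,
    (continuous_const.add (continuous_tailIntegral g)).continuousOn,
    coeFn_affinePrimitive a g, by simp only [tailIntegral_self, add_zero]⟩

theorem HasFinalValue.eq_trajectory (hT : 0 < T) {m : W U T} {a : V U} (h : HasFinalValue m a) :
    m = trajectory U hT (a, -dt m) := by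
  obtain ⟨r, hr, hmr, hra⟩ := h
  have hval : val m = affinePrimitive T a (-dt m) := by
    rw [← hra]
    exact eq_affinePrimitive_of_weakDeriv hT hr hmr fun η h1 h2 h3 l => m.2 η h1 h2 h3 l
  refine Subtype.ext ((WithLp.equiv 2 _).injective (Prod.ext hval ?_))
  exact (neg_neg (dt m)).symm

/-! ### The weak formulations as operator equations -/

section Equations

variable {S : Set E3} {c₁ c₂ μ₁ μ₂ ν₁ ν₂ : ℝ}

/-- The Riesz representative of `w ↦ ∫ A I^{pq} · e(w)`. -/
def unitLoad (U : Set E3) [IsFiniteMeasure (volU U)] (c₁ c₂ : ℝ) (hS : MeasurableSet S)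
    (p q : Fin 3) : V U :=
  (strainL U).adjoint (tensorL U c₁ c₂ hS (Lp.const 2 (volU U) (unitStrain p q)))

theorem norm_unitLoad_le [IsFiniteMeasure (volU U)] (h₁ : 0 < c₁) (h₂ : 0 < c₂)
    (hS : MeasurableSet S) (p q : Fin 3) : ‖unitLoad U c₁ c₂ hS p q‖ ≤
      max c₁ c₂ * ‖Lp.const 2 (volU U) (unitStrain p q)‖ :=
  (norm_adjoint_strainL_le _).trans (norm_tensorL_le h₁ h₂ hS _)

theorem isSolN_iff [IsFiniteMeasure (volU U)] (hS : MeasurableSet S) (p q : Fin 3) (f n : V U) :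
    IsSolN S c₁ c₂ p q (InnerProductSpace.toDual ℝ (V U) f) n ↔
      stiffness U c₁ c₂ hS n = f - unitLoad U c₁ c₂ hS p q := by
  rw [eq_sub_iff_add_eq', ← eq_toDual_iff]
  refine forall_congr' fun w => ?_
  rw [integral_tensor_strain hS (Lp.const 2 (volU U) (unitStrain p q) + strainL U n) (by
      filter_upwards [Lp.coeFn_add (Lp.const 2 (volU U) (unitStrain p q)) (strainL U n),
        Lp.coeFn_const (p := 2) (μ := volU U) (unitStrain p q), coeFn_strainL n] with x h1 h2 h3
      rw [h1, Pi.add_apply, h2, h3]; rfl), map_add, map_add]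
  rfl

theorem isSolMT_iff [IsFiniteMeasure (volU U)] (hS : MeasurableSet S) (p q : Fin 3)
    (f n a : V U) :
    IsSolMT S c₁ c₂ p q (InnerProductSpace.toDual ℝ (V U) f) n a ↔
      stiffness U c₁ c₂ hS a =
        stiffness U c₁ c₂ hS n - (f - unitLoad U c₁ c₂ hS p q) := by
  have : stiffness U c₁ c₂ hS a = stiffness U c₁ c₂ hS n - (f - unitLoad U c₁ c₂ hS p q) ↔
      unitLoad U c₁ c₂ hS p q + stiffness U c₁ c₂ hS n - stiffness U c₁ c₂ hS a = f := by
    constructor <;> intro h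
    · rw [h]; abel
    · rw [← h]; abel
  rw [this, ← eq_toDual_iff]
  refine forall_congr' fun w => ?_
  rw [integral_tensor_strain hS (Lp.const 2 (volU U) (unitStrain p q) + strainL U n - strainL U a)
    (by
      filter_upwards [Lp.coeFn_sub (Lp.const 2 (volU U) (unitStrain p q) + strainL U n)
        (strainL U a), Lp.coeFn_add (Lp.const 2 (volU U) (unitStrain p q)) (strainL U n),
        Lp.coeFn_const (p := 2) (μ := volU U) (unitStrain p q), coeFn_strainL n,
        coeFn_strainL a] with x h0 h1 h2 h3 h4
      rw [h0, Pi.sub_apply, h1, Pi.add_apply, h2, h3, h4]; rfl), map_sub, map_add, map_sub, map_add]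
  rfl

theorem integral_viscoelastic (hS : MeasurableSet S) (v v' w : V U) :
    ∫ x in U, inner ℝ (tensor S μ₁ μ₂ x (strain v x) - tensor S ν₁ ν₂ x (strain v' x))
      (strain w x) = inner ℝ (stiffness U μ₁ μ₂ hS v - stiffness U ν₁ ν₂ hS v') w := by
  rw [inner_sub_left, inner_stiffness, inner_stiffness, ← inner_sub_left, L2.inner_def]
  refine integral_congr_ae ?_
  filter_upwards [Lp.coeFn_sub (tensorL U μ₁ μ₂ hS (strainL U v))
      (tensorL U ν₁ ν₂ hS (strainL U v')),
    coeFn_tensorL (c₁ := μ₁) (c₂ := μ₂) hS (strainL U v),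
    coeFn_tensorL (c₁ := ν₁) (c₂ := ν₂) hS (strainL U v'),
    coeFn_strainL v, coeFn_strainL v', coeFn_strainL w] with x h0 h1 h2 h3 h4 h5
  rw [h0, Pi.sub_apply, h1, h2, h3, h4, h5]

theorem isSolM_iff (hT : 0 < T) (hS : MeasurableSet S) (f : VT U T) (a : V U) (z : W U T) :
    IsSolM S μ₁ μ₂ ν₁ ν₂ (InnerProductSpace.toDual ℝ (VT U T) f) a z ↔
      ∃ g, z = trajectory U hT (a, g) ∧
        evolutionOp T (stiffness U μ₁ μ₂ hS) (stiffness U ν₁ ν₂ hS) g =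
          f - (stiffness U μ₁ μ₂ hS).compLpL 2 (volT T) (Lp.constL 2 (volT T) ℝ a) := by
  have key : ∀ g : VT U T, (∀ φ : VT U T, ∫ t in Ioo 0 T, ∫ x in U,
      inner ℝ (tensor S μ₁ μ₂ x (strain (val (trajectory U hT (a, g)) t) x) -
        tensor S ν₁ ν₂ x (strain (dt (trajectory U hT (a, g)) t) x)) (strain (φ t) x) =
          InnerProductSpace.toDual ℝ (VT U T) f φ) ↔
      evolutionOp T (stiffness U μ₁ μ₂ hS) (stiffness U ν₁ ν₂ hS) g =
        f - (stiffness U μ₁ μ₂ hS).compLpL 2 (volT T) (Lp.constL 2 (volT T) ℝ a) := by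
    intro g
    refine Iff.trans (forall_congr' fun φ => ?_) (evolutionOp_eq_iff _ _ a g f).symm
    simp_rw [integral_viscoelastic hS]
    rfl
  constructor
  · rintro ⟨h1, h2⟩
    have hz := h1.eq_trajectory hT
    rw [hz] at h2
    exact ⟨_, hz, (key _).1 h2⟩
  · rintro ⟨g, rfl, hg⟩
    exact ⟨hasFinalValue_trajectory hT a g, (key g).2 hg⟩

end Equations

/-! ### Weak and strong convergence of trajectories -/

theorem weaklyNull_trajectory (hT : 0 < T) {a : ℕ → V U} {g : ℕ → VT U T} (ha : WeaklyNull a)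
    (hg : WeaklyNull g) : WeaklyNull fun k => trajectory U hT (a k, g k) := by
  have h1 := ha.map ((trajectory U hT).comp (ContinuousLinearMap.inl ℝ (V U) (VT U T)))
  have h2 := hg.map ((trajectory U hT).comp (ContinuousLinearMap.inr ℝ (V U) (VT U T)))
  have h3 := h1.add h2
  refine (congrArg WeaklyNull (funext fun k => ?_)).mp h3
  simp only [ContinuousLinearMap.comp_apply, ContinuousLinearMap.inl_apply,
    ContinuousLinearMap.inr_apply, ← map_add, Prod.mk_add_mk, add_zero, zero_add]

theorem tendsto_toL2L2_trajectory (hUb : Bornology.IsBounded U) (hT : 0 < T) {a : ℕ → V U}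
    {g : ℕ → VT U T} (ha : WeaklyNull a) (hg : WeaklyNull g) :
    Tendsto (fun k => toL2L2 (trajectory U hT (a k, g k))) atTop (𝓝 0) :=
  tendsto_compLp_affinePrimitive (toL2 U) (fun _ hv => hv.tendsto_toL2 hUb) ha hg

end Trajectories

end

end Viscoelastic

theorem proposition4p3
    -- a bounded open set, a final time, the first phases `S k` (the second ones are `U \ S k`)
    (U : Set Viscoelastic.E3) (hU : IsOpen U) (hUb : Bornology.IsBounded U)
    (T : ℝ) (hT : 0 < T)
    (S : ℕ → Set Viscoelastic.E3) (hS : ∀ k, MeasurableSet (S k))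
    -- the elastic moduli and the viscosities of the two phases
    (μ₁ μ₂ ν₁ ν₂ : ℝ) (hμ₁ : 0 < μ₁) (hμ₂ : 0 < μ₂) (hν₁ : 0 < ν₁) (hν₂ : 0 < ν₂) :
    -- the final data `mT k` of the paper's construction can be made weakly null
    (∀ p q : Fin 3, ∃ f₁ f₂ : StrongDual ℝ (Viscoelastic.V U), ∃ n mT : ℕ → Viscoelastic.V U,
      (∀ k v, Viscoelastic.IsSolN (S k) μ₁ μ₂ p q f₁ v ↔ v = n k) ∧
      (∀ k v, Viscoelastic.IsSolMT (S k) ν₁ ν₂ p q f₂ (n k) v ↔ v = mT k) ∧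
      ∃ σ : ℕ → ℕ, StrictMono σ ∧
        Viscoelastic.WeaklyNull (n ∘ σ) ∧ Viscoelastic.WeaklyNull (mT ∘ σ)) ∧
    -- for these, and for all final data that are weakly null along a subsequence `σ`,
    -- there is a right-hand side `f` as asserted
    (∀ (mT : ℕ → Viscoelastic.V U) (σ : ℕ → ℕ), StrictMono σ →
      Viscoelastic.WeaklyNull (mT ∘ σ) →
      ∃ f : StrongDual ℝ (Viscoelastic.VT U T), ∃ m : ℕ → Viscoelastic.W U T,
        (∀ k z, Viscoelastic.IsSolM (S k) μ₁ μ₂ ν₁ ν₂ f (mT k) z ↔ z = m k) ∧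
        ∃ τ : ℕ → ℕ, StrictMono τ ∧
          Viscoelastic.WeaklyNull (m ∘ σ ∘ τ) ∧
          Tendsto (fun k => Viscoelastic.toL2L2 (m (σ (τ k)))) atTop (𝓝 0)) := by
  obtain ⟨c, hc0, hc⟩ := Viscoelastic.exists_coercive_strainL hUb
  have hfin : IsFiniteMeasure (Viscoelastic.volU U) := ⟨by simpa using hUb.measure_lt_top⟩
  have hcμ : 0 < min μ₁ μ₂ * c := mul_pos (lt_min hμ₁ hμ₂) hc0
  have hcν : 0 < min ν₁ ν₂ * c := mul_pos (lt_min hν₁ hν₂) hc0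
  have hMμ : 0 < max μ₁ μ₂ := lt_max_of_lt_left hμ₁
  have hMν : 0 < max ν₁ ν₂ := lt_max_of_lt_left hν₁
  have hA := fun k => Viscoelastic.le_inner_stiffness hμ₁ hμ₂ (hS k) hc
  have hB := fun k => Viscoelastic.le_inner_stiffness hν₁ hν₂ (hS k) hc
  refine ⟨fun p q => ?_, fun mT σ hσ hmT => ?_⟩
  · choose eA heA using fun k => Viscoelastic.exists_equiv_of_coercive _ hcμ (hA k)
    choose eB heB using fun k => Viscoelastic.exists_equiv_of_coercive _ hcν (hB k)
    have hA' : ∀ k u, min μ₁ μ₂ * c * ‖u‖ ^ 2 ≤ inner ℝ (eA k u) u := fun k u => by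
      rw [heA]; exact hA k u
    have hB' : ∀ k u, min ν₁ ν₂ * c * ‖u‖ ^ 2 ≤ inner ℝ (eB k u) u := fun k u => by
      rw [heB]; exact hB k u
    -- the responses to the loads `w ↦ ∫ A I^{pq} · e(w)` and `w ↦ ∫ B I^{pq} · e(w)`
    let zA := fun k => (eA k).symm (Viscoelastic.unitLoad U μ₁ μ₂ (hS k) p q)
    let zB := fun k => (eB k).symm (Viscoelastic.unitLoad U ν₁ ν₂ (hS k) p q)
    obtain ⟨f₁, τ₁, hτ₁, hn⟩ := Viscoelastic.exists_rhs_weaklyNull eA zA hcμ hMμ hA'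
      (fun k u => by rw [heA]; exact Viscoelastic.norm_stiffness_le hμ₁ hμ₂ (hS k) u)
      (fun k => (Viscoelastic.norm_symm_apply_le hcμ (hA' k) _).trans
        (mul_le_mul_of_nonneg_left (Viscoelastic.norm_unitLoad_le hμ₁ hμ₂ (hS k) p q)
          (inv_nonneg.2 hcμ.le)))
    obtain ⟨f₂, τ₂, hτ₂, hm⟩ := Viscoelastic.exists_rhs_weaklyNull (fun k => eB (τ₁ k))
      (fun k => zB (τ₁ k)) hcν hMν (fun k => hB' (τ₁ k))
      (fun k u => by rw [heB]; exact Viscoelastic.norm_stiffness_le hν₁ hν₂ (hS (τ₁ k)) u)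
      (fun k => (Viscoelastic.norm_symm_apply_le hcν (hB' (τ₁ k)) _).trans
        (mul_le_mul_of_nonneg_left (Viscoelastic.norm_unitLoad_le hν₁ hν₂ (hS (τ₁ k)) p q)
          (inv_nonneg.2 hcν.le)))
    refine ⟨InnerProductSpace.toDual ℝ _ f₁, InnerProductSpace.toDual ℝ _ f₂,
      fun k => (eA k).symm f₁ - zA k,
      fun k => ((eA k).symm f₁ - zA k) - ((eB k).symm f₂ - zB k), fun k v => ?_, fun k v => ?_,
      τ₁ ∘ τ₂, hτ₁.comp hτ₂, hn.subseq hτ₂, (hn.subseq hτ₂).sub hm⟩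
    · rw [Viscoelastic.isSolN_iff (hS k), ← heA, Viscoelastic.equiv_apply_eq_sub_iff]
    · rw [Viscoelastic.isSolMT_iff (hS k), ← heB, ← heB, Viscoelastic.equiv_apply_eq_sub_iff,
        map_sub (eB k).symm, ContinuousLinearEquiv.symm_apply_apply]
  · obtain ⟨f, g, hfg, τ, hτ, hg⟩ := Viscoelastic.exists_rhs_evolution hT hcν hMμ hMν
      (fun k => Viscoelastic.inner_stiffness_comm (c₁ := μ₁) (c₂ := μ₂) (hS k))
      (fun k v => (mul_nonneg hcμ.le (sq_nonneg _)).trans (hA k v)) hB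
      (fun k => Viscoelastic.norm_stiffness_le hμ₁ hμ₂ (hS k))
      (fun k => Viscoelastic.norm_stiffness_le hν₁ hν₂ (hS k)) mT hmT
    refine ⟨InnerProductSpace.toDual ℝ _ f, fun k => Viscoelastic.trajectory U hT (mT k, g k),
      fun k z => ?_, τ, hτ, Viscoelastic.weaklyNull_trajectory hT (hmT.subseq hτ) hg,
      Viscoelastic.tendsto_toL2L2_trajectory hUb hT (hmT.subseq hτ) hg⟩
    rw [Viscoelastic.isSolM_iff hT (hS k)]
    constructor
    · rintro ⟨u, rfl, h⟩
      rw [(hfg k u).1 h]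
    · rintro rfl
      exact ⟨_, rfl, (hfg k _).2 rfl⟩
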